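/- Let $p$ be an odd prime, let $R=\widehat{\mathbb Z_p^{ur}}=W(\overline{\mathbb F}_p)$ be the $p$-adic completion of the ring of integers of the maximal unramified extension of $\mathbb Q_p$, let $\phi$ be the automorphism of $R$ lifting the $p$-power Frobenius of $k=R/pR$, and let $\delta a=(\phi(a)-a^p)/p$ be the corresponding $p$-derivation of $R$. Equip the polynomial ring $R\{x\}=R[x,x',x'',\dots]$ with the unique $p$-derivation $\delta$ that extends the one on $R$ and satisfies $\delta x^{(i)}=x^{(i+1)}$ for all $i\ge 0$ (where $x^{(0)}=x$). For $n\ge 0$ let $$\mathcal O^n(\mathbb G_m)=R[x,x^{-1},x',\dots,x^{(n)}]^{\wedge}$$ ($p$-adic completion) be the ring of functions on the $p$-jet space $J^n(\mathbb G_m)$, and let $\overline{\mathcal O^n(\mathbb G_m)}=\mathcal O^n(\mathbb G_m)\otimes_R k$. For $\nu\ge 0$ let $[p^\nu]^*:\mathcal O^n(\mathbb G_m)\to\mathcal O^n(\mathbb G_m)$ be the $R$-algebra homomorphism given by multiplication by $p^\nu$ on $J^n(\mathbb G_m)$, that is, the homomorphism induced on completions by $$x\mapsto x^{p^\nu},\quad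 x'\mapsto\delta(x^{p^\nu}),\ \dots,\ x^{(n)}\mapsto\delta^n(x^{p^\nu}),$$ and let $\overline{[p^\nu]^*}$ be its reduction $[p^\nu]^*\otimes_R k$. Let $n\ge\nu+1$. Then the natural map $\overline{\mathcal O^{n-\nu}(\mathbb G_m)}\to\overline{\mathcal O^n(\mathbb G_m)}$ is injective, and $\overline{[p^\nu]^*}$ induces an injective, finite and flat homomorphism $$\overline{\mathcal O^n(\mathbb G_m)}/(x',\dots,x^{(\nu)})\longrightarrow\overline{\mathcal O^{n-\nu}(\mathbb G_m)};$$ that is, there is an $R$-algebra homomorphism between these rings which is injective, finite and flat and whose composite with the projection $\overline{\mathcal O^n(\mathbb G_m)}\to\overline{\mathcal O^n(\mathbb G_m)}/(x',\dots,x^{(\nu)})$ and with the natural map $\overline{\mathcal O^{n-\nu}(\mathbb G_m)}\to\overline{\mathcal O^n(\mathbb G_m)}$ is $\overline{[p^\nu]^*}$. -/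

import Mathlib

open scoped TensorProduct

noncomputable section

namespace PJet

section PDerivations

variable {A : Type*} [CommRing A]

/-- The value at `(x, y)` of the integral polynomial
`C_p(X, Y) = (X ^ p + Y ^ p - (X + Y) ^ p) / p`. -/
def fermatC (p : ℕ) (x y : A) : A :=
  -∑ i ∈ Finset.Ioo 0 p, ((p.choose i / p : ℕ) : A) * x ^ i * y ^ (p - i)

/-- `δ` is a `p`-derivation on the ring `A`. -/
structure IsPDerivation (p : ℕ) (δ : A → A) : Prop where
  map_one : δ 1 = 0
  map_add : ∀ x y, δ (x + y) = δ x + δ y + fermatC p x y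
  map_mul : ∀ x y, δ (x * y) = x ^ p * δ y + y ^ p * δ x + p * (δ x * δ y)

theorem p_mul_fermatC (p : ℕ) [hp : Fact p.Prime] (x y : A) :
    (p : A) * fermatC p x y = x ^ p + y ^ p - (x + y) ^ p := by
  have hp0 := hp.out.pos
  have h1 : (x + y) ^ p = y ^ p + (∑ i ∈ Finset.Ioo 0 p,
      x ^ i * y ^ (p - i) * (p.choose i : A)) + x ^ p := by
    rw [add_pow, Finset.sum_range_succ, Finset.range_eq_Ico, Finset.sum_eq_sum_Ico_succ_bot hp0]
    have : Finset.Ico (0 + 1) p = Finset.Ioo 0 p := by ext; simp; omega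
    rw [this]
    simp
  rw [h1, fermatC, mul_neg, Finset.mul_sum]
  have h2 : ∀ i ∈ Finset.Ioo 0 p, (p : A) * (((p.choose i / p : ℕ) : A) * x ^ i * y ^ (p - i)) =
      x ^ i * y ^ (p - i) * (p.choose i : A) := by
    intro i hi
    rw [Finset.mem_Ioo] at hi
    have h3 : p * (p.choose i / p) = p.choose i :=
      Nat.mul_div_cancel' (hp.out.dvd_choose_self (by omega) hi.2)
    calc _ = ((p * (p.choose i / p) : ℕ) : A) * (x ^ i * y ^ (p - i)) := by push_cast; ring
      _ = _ := by rw [h3]; ring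
  rw [Finset.sum_congr rfl h2]
  ring

/-- The operator `δ a = (φ a - a ^ p) / p` attached to a lift of Frobenius `φ`.
(On a `p`-torsion free ring the quotient is unique.) -/
def fermatQuotient (p : ℕ) (φ : A →+* A) (h : ∀ a, (p : A) ∣ φ a - a ^ p) (a : A) : A :=
  (h a).choose

theorem p_mul_fermatQuotient (p : ℕ) (φ : A →+* A) (h : ∀ a, (p : A) ∣ φ a - a ^ p) (a : A) :
    (p : A) * fermatQuotient p φ h a = φ a - a ^ p :=
  (h a).choose_spec.symm

theorem isPDerivation_fermatQuotient (p : ℕ) [Fact p.Prime] [IsDomain A]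
    (hp0 : (p : A) ≠ 0) (φ : A →+* A) (h : ∀ a, (p : A) ∣ φ a - a ^ p) :
    IsPDerivation p (fermatQuotient p φ h) := by
  have key := p_mul_fermatQuotient p φ h
  refine ⟨?_, fun x y => ?_, fun x y => ?_⟩ <;> apply mul_left_cancel₀ hp0
  · rw [key]; simp
  · rw [mul_add, mul_add, key, key, key, p_mul_fermatC, map_add]; ring
  · have hx : φ x = x ^ p + p * fermatQuotient p φ h x := by rw [key]; ring
    have hy : φ y = y ^ p + p * fermatQuotient p φ h y := by rw [key]; ring
    rw [key, map_mul, hx, hy]; ring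

end PDerivations

section BaseRing

variable (p : ℕ) [hp : Fact p.Prime]

/-- The `p`-adic completion of the ring of integers `ℤ_p^ur` of the maximal unramified extension
of `ℚ_p`, realized as the ring of Witt vectors of an algebraic closure of `𝔽_p`. -/
abbrev ZpUr : Type := WittVector p (AlgebraicClosure (ZMod p))

/-- The residue field `k = R / pR`. -/
abbrev ResField : Type := ZpUr p ⧸ Ideal.span {(p : ZpUr p)}

theorem p_dvd_frobenius_sub (a : ZpUr p) : (p : ZpUr p) ∣ WittVector.frobenius a - a ^ p := by
  rw [← Ideal.mem_span_singleton, WittVector.mem_span_p_iff_coeff_zero_eq_zero]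
  change WittVector.constantCoeff (WittVector.frobenius a - a ^ p) = 0
  rw [map_sub, map_pow]
  change (WittVector.frobenius a).coeff 0 - (a.coeff 0) ^ p = 0
  rw [WittVector.coeff_frobenius_charP, sub_self]

/-- The `p`-derivation `δ a = (φ a - a ^ p) / p` of `R`, where `φ` is the automorphism of `R`
lifting the `p`-power Frobenius of `R / pR`. -/
def deltaR : ZpUr p → ZpUr p :=
  fermatQuotient p WittVector.frobenius (p_dvd_frobenius_sub p)

theorem isPDerivation_deltaR : IsPDerivation p (deltaR p) :=
  isPDerivation_fermatQuotient p (WittVector.p_nonzero p _) _ _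

end BaseRing

section DeltaPolynomials

variable (p : ℕ) [hp : Fact p.Prime]

open MvPolynomial

/-- The ring `R{x} = R[x, x', x'', …]`; the variable `x^(i)` is `X i`. -/
abbrev DeltaPoly : Type := MvPolynomial ℕ (ZpUr p)

/-- The lift of Frobenius on `R{x}` extending the one of `R`, with
`φ (x^(i)) = (x^(i)) ^ p + p x^(i+1)`. -/
def phi : DeltaPoly p →+* DeltaPoly p :=
  eval₂Hom (C.comp (WittVector.frobenius : ZpUr p →+* ZpUr p))
    (fun i => X i ^ p + (p : DeltaPoly p) * X (i + 1))

theorem p_dvd_phi_sub (f : DeltaPoly p) : (p : DeltaPoly p) ∣ phi p f - f ^ p := by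
  induction f using MvPolynomial.induction_on with
  | C a =>
    have h1 : phi p (C a) = C (WittVector.frobenius a) := by simp [phi]
    obtain ⟨b, hb⟩ := p_dvd_frobenius_sub p a
    refine ⟨C b, ?_⟩
    rw [h1, ← map_pow, ← map_sub, hb, map_mul, map_natCast]
  | add f g hf hg =>
    have h1 : phi p (f + g) - (f + g) ^ p =
        (phi p f - f ^ p) + (phi p g - g ^ p) + p * fermatC p f g := by
      rw [p_mul_fermatC, map_add]; ring
    rw [h1]
    exact dvd_add (dvd_add hf hg) (dvd_mul_right _ _)
  | mul_X f i hf =>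
    have h1 : phi p (X i) = X i ^ p + (p : DeltaPoly p) * X (i + 1) := by simp [phi]
    have h2 : phi p (f * X i) - (f * X i) ^ p =
        (phi p f - f ^ p) * X i ^ p + (p : DeltaPoly p) * (phi p f * X (i + 1)) := by
      rw [map_mul, h1]; ring
    rw [h2]
    exact dvd_add (hf.mul_right _) (dvd_mul_right _ _)

/-- The `p`-derivation of `R{x}`: the unique one that extends `δ` on `R` and satisfies
`δ (x^(i)) = x^(i+1)`. -/
def delta : DeltaPoly p → DeltaPoly p :=
  fermatQuotient p (phi p) (p_dvd_phi_sub p)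

theorem p_mul_delta (f : DeltaPoly p) : (p : DeltaPoly p) * delta p f = phi p f - f ^ p :=
  p_mul_fermatQuotient p _ _ f

theorem p_ne_zero : (p : DeltaPoly p) ≠ 0 := by
  rw [← map_natCast (C : ZpUr p →+* DeltaPoly p)]
  exact C_ne_zero.mpr (WittVector.p_nonzero p _)

theorem isPDerivation_delta : IsPDerivation p (delta p) :=
  isPDerivation_fermatQuotient p (p_ne_zero p) _ _

theorem delta_X (i : ℕ) : delta p (X i) = X (i + 1) := by
  apply mul_left_cancel₀ (p_ne_zero p)
  rw [p_mul_delta]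
  simp [phi]

theorem delta_C (a : ZpUr p) : delta p (C a) = C (deltaR p a) := by
  apply mul_left_cancel₀ (p_ne_zero p)
  have h : (p : ZpUr p) * deltaR p a = WittVector.frobenius a - a ^ p :=
    p_mul_fermatQuotient p _ _ a
  rw [p_mul_delta, ← map_natCast (C : ZpUr p →+* DeltaPoly p), ← map_mul, h]
  simp [phi]

/-- The subring `A^n = R[x, x', …, x^(n)]` of `R{x}`. -/
abbrev jetPoly (n : ℕ) : Subalgebra (ZpUr p) (DeltaPoly p) :=
  supported (ZpUr p) (Set.Iic n)

theorem jetPoly_mono {m n : ℕ} (h : m ≤ n) : jetPoly p m ≤ jetPoly p n :=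
  supported_mono (Set.Iic_subset_Iic.mpr h)

theorem X_mem_jetPoly {i n : ℕ} (h : i ≤ n) : (X i : DeltaPoly p) ∈ jetPoly p n :=
  X_mem_supported.mpr h

theorem phi_mem {n : ℕ} {f : DeltaPoly p} (hf : f ∈ jetPoly p n) : phi p f ∈ jetPoly p (n + 1) := by
  have hle : (jetPoly p n).toSubring ≤ (jetPoly p (n + 1)).toSubring.comap (phi p) := by
    intro g hg
    have hg' : g ∈ Algebra.adjoin (ZpUr p) (X '' Set.Iic n) := hg
    induction hg' using Algebra.adjoin_induction with
    | mem x hx =>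
      obtain ⟨i, hi, rfl⟩ := hx
      have h1 : phi p (X i) = X i ^ p + (p : DeltaPoly p) * X (i + 1) := by simp [phi]
      change phi p (X i) ∈ jetPoly p (n + 1)
      rw [h1]
      have hi' : i ≤ n := hi
      exact add_mem (pow_mem (X_mem_jetPoly p (by omega)) _)
        (mul_mem (natCast_mem _ _) (X_mem_jetPoly p (by omega)))
    | algebraMap r =>
      have h1 : phi p (algebraMap _ _ r) = algebraMap _ _ (WittVector.frobenius r) := by
        simp [phi, MvPolynomial.algebraMap_eq]
      change phi p (algebraMap _ _ r) ∈ jetPoly p (n + 1)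
      rw [h1]
      exact Subalgebra.algebraMap_mem _ _
    | add x y hx hy h1 h2 => exact add_mem (h1 hx) (h2 hy)
    | mul x y hx hy h1 h2 => exact mul_mem (h1 hx) (h2 hy)
  exact hle hf

/-- `δ A^n ⊆ A^(n+1)`. -/
theorem delta_mem {n : ℕ} {f : DeltaPoly p} (hf : f ∈ jetPoly p n) :
    delta p f ∈ jetPoly p (n + 1) := by
  have h1 : (p : DeltaPoly p) * delta p f ∈ jetPoly p (n + 1) := by
    rw [p_mul_delta]
    exact sub_mem (phi_mem p hf) (pow_mem (jetPoly_mono p (Nat.le_succ n) hf) _)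
  have h0 : (p : ZpUr p) ≠ 0 := WittVector.p_nonzero p _
  rw [mem_supported] at h1 ⊢
  intro i hi
  apply h1
  rw [← map_natCast (C : ZpUr p →+* DeltaPoly p), ← smul_eq_C_mul]
  rw [Finset.mem_coe, mem_vars_iff_mem_support] at hi ⊢
  obtain ⟨d, hd, hid⟩ := hi
  refine ⟨d, ?_, hid⟩
  rw [mem_support_iff] at hd ⊢
  rw [coeff_smul]
  exact mul_ne_zero h0 hd

/-- The endomorphism of `R{x}` with `x^(i) ↦ δ^i (x ^ (p ^ ν))`, for all `i ≥ 0`. -/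
def powPoly (ν : ℕ) : DeltaPoly p →ₐ[ZpUr p] DeltaPoly p :=
  aeval (fun i => (delta p)^[i] (X 0 ^ p ^ ν))

theorem iterate_delta_mem (ν i : ℕ) : (delta p)^[i] (X 0 ^ p ^ ν) ∈ jetPoly p i := by
  induction i with
  | zero => exact pow_mem (X_mem_jetPoly p le_rfl) _
  | succ i ih => rw [Function.iterate_succ_apply']; exact delta_mem p ih

theorem powPoly_mem (ν : ℕ) {n : ℕ} (f : jetPoly p n) : powPoly p ν f ∈ jetPoly p n := by
  have hle : jetPoly p n ≤ (jetPoly p n).comap (powPoly p ν) := by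
    refine Algebra.adjoin_le ?_
    rintro _ ⟨i, hi, rfl⟩
    change powPoly p ν (X i) ∈ jetPoly p n
    rw [powPoly, aeval_X]
    exact jetPoly_mono p hi (iterate_delta_mem p ν i)
  exact hle f.2

/-- The endomorphism of `R[x, x', …, x^(n)]` with `x^(i) ↦ δ^i (x ^ (p ^ ν))`. -/
def powJetPoly (ν n : ℕ) : jetPoly p n →ₐ[ZpUr p] jetPoly p n :=
  ((powPoly p ν).comp (jetPoly p n).val).codRestrict _ (powPoly_mem p ν)

end DeltaPolynomials

section Laurent

variable (p : ℕ) [hp : Fact p.Prime]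

open MvPolynomial

/-- The element `x` of `R[x, x', …, x^(n)]`. -/
def xCoord (n : ℕ) : jetPoly p n := ⟨X 0, X_mem_jetPoly p (Nat.zero_le n)⟩

/-- The ring `R[x, x⁻¹, x', …, x^(n)]`. -/
abbrev GmPoly (n : ℕ) : Type := Localization.Away (xCoord p n)

/-- The `R`-algebra homomorphism `R[x, x⁻¹, x', …, x^(m)] → R[x, x⁻¹, x', …, x^(n)]` induced by an
`R`-algebra homomorphism `R[x, x', …, x^(m)] → R[x, x', …, x^(n)]` that sends `x` to a power
of `x`. -/
def GmPoly.lift {m n : ℕ} (g : jetPoly p m →ₐ[ZpUr p] jetPoly p n)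
    (hg : ∃ N, g (xCoord p m) = xCoord p n ^ N) : GmPoly p m →ₐ[ZpUr p] GmPoly p n :=
  IsLocalization.liftAlgHom (M := Submonoid.powers (xCoord p m))
    (f := (IsScalarTower.toAlgHom (ZpUr p) (jetPoly p n) (GmPoly p n)).comp g)
    (by
      rintro ⟨_, r, rfl⟩
      obtain ⟨N, hN⟩ := hg
      have hu : IsUnit (algebraMap (jetPoly p n) (GmPoly p n) (xCoord p n)) :=
        IsLocalization.Away.algebraMap_isUnit _
      simp only [map_pow, AlgHom.comp_apply, hN]
      exact (hu.pow N).pow r)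

/-- The inclusion `R[x, x⁻¹, x', …, x^(m)] ⊆ R[x, x⁻¹, x', …, x^(n)]` for `m ≤ n`. -/
def inclGmPoly {m n : ℕ} (h : m ≤ n) : GmPoly p m →ₐ[ZpUr p] GmPoly p n :=
  GmPoly.lift p (Subalgebra.inclusion (jetPoly_mono p h)) ⟨1, by rw [pow_one]; rfl⟩

/-- The endomorphism of `R[x, x⁻¹, x', …, x^(n)]` with `x^(i) ↦ δ^i (x ^ (p ^ ν))`. -/
def powGmPoly (ν n : ℕ) : GmPoly p n →ₐ[ZpUr p] GmPoly p n :=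
  GmPoly.lift p (powJetPoly p ν n) ⟨p ^ ν, Subtype.ext (by
    simp [powJetPoly, powPoly, xCoord])⟩

end Laurent

section Completion

variable (p : ℕ) {R A B : Type*} [CommRing R] [CommRing A] [CommRing B] [Algebra R A] [Algebra R B]

/-- The `p`-adic completion of a ring. -/
abbrev PCompletion (A : Type*) [CommRing A] : Type _ := AdicCompletion (Ideal.span {(p : A)}) A

theorem span_pow_le_comap (f : A →ₐ[R] B) (m : ℕ) :
    Ideal.span {(p : A)} ^ m ≤ (Ideal.span {(p : B)} ^ m).comap f := by
  rw [← Ideal.map_le_iff_le_comap, Ideal.map_pow, Ideal.map_span]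
  simp

theorem PCompletion.map_compat (f : A →ₐ[R] B) {m n : ℕ} (hle : m ≤ n) :
    (Ideal.Quotient.factorₐ R (Ideal.pow_le_pow_right hle)).comp
      ((Ideal.quotientMapₐ (Ideal.span {(p : B)} ^ n) f (span_pow_le_comap p f n)).comp
        ((AdicCompletion.evalₐ (Ideal.span {(p : A)}) n).restrictScalars R)) =
      (Ideal.quotientMapₐ (Ideal.span {(p : B)} ^ m) f (span_pow_le_comap p f m)).comp
        ((AdicCompletion.evalₐ (Ideal.span {(p : A)}) m).restrictScalars R) := by
  ext x
  obtain ⟨a, rfl⟩ := AdicCompletion.mk_surjective _ _ x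
  change Ideal.Quotient.mk (Ideal.span {(p : B)} ^ m) (f (a.val n)) =
    Ideal.Quotient.mk (Ideal.span {(p : B)} ^ m) (f (a.val m))
  have h := AdicCompletion.Ideal.mk_eq_mk (Ideal.span {(p : A)}) hle a
  rw [Ideal.Quotient.eq] at h ⊢
  rw [← map_sub]
  exact span_pow_le_comap p f m h

/-- The map on `p`-adic completions induced by an algebra homomorphism: the inverse limit of the
maps `A / p ^ m → B / p ^ m`. -/
def PCompletion.map (f : A →ₐ[R] B) : PCompletion p A →ₐ[R] PCompletion p B :=
  AdicCompletion.liftAlgHom (Ideal.span {(p : B)})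
    (fun m => (Ideal.quotientMapₐ _ f (span_pow_le_comap p f m)).comp
      ((AdicCompletion.evalₐ (Ideal.span {(p : A)}) m).restrictScalars R))
    (PCompletion.map_compat p f)

end Completion

section Jets

variable (p : ℕ) [hp : Fact p.Prime]

/-- The ring `𝒪^n(𝔾_m) = R[x, x⁻¹, x', …, x^(n)]^` of functions on the `p`-jet space
`J^n(𝔾_m)`. -/
abbrev JetGm (n : ℕ) : Type := PCompletion p (GmPoly p n)

/-- The natural map `𝒪^m(𝔾_m) → 𝒪^n(𝔾_m)` for `m ≤ n`. -/
def jetIncl {m n : ℕ} (h : m ≤ n) : JetGm p m →ₐ[ZpUr p] JetGm p n :=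
  PCompletion.map p (inclGmPoly p h)

/-- The map `[p^ν]^* : 𝒪^n(𝔾_m) → 𝒪^n(𝔾_m)` given by multiplication by `p^ν` on `J^n(𝔾_m)`,
that is, by `x ↦ x ^ (p ^ ν)`, `x' ↦ δ (x ^ (p ^ ν))`, …, `x^(n) ↦ δ^n (x ^ (p ^ ν))`. -/
def powJet (ν n : ℕ) : JetGm p n →ₐ[ZpUr p] JetGm p n :=
  PCompletion.map p (powGmPoly p ν n)

/-- The reduction mod `p` of `𝒪^n(𝔾_m)`, that is, `𝒪^n(𝔾_m) ⊗_R k`. -/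
abbrev JetGmBar (n : ℕ) : Type := JetGm p n ⊗[ZpUr p] ResField p

/-- The natural map from `𝒪^m(𝔾_m)` to `𝒪^n(𝔾_m)`, for `m ≤ n`, reduced mod `p`. -/
def jetInclBar {m n : ℕ} (h : m ≤ n) : JetGmBar p m →ₐ[ZpUr p] JetGmBar p n :=
  Algebra.TensorProduct.map (jetIncl p h) (AlgHom.id _ _)

/-- The map `[p^ν]^*` reduced mod `p`. -/
def powJetBar (ν n : ℕ) : JetGmBar p n →ₐ[ZpUr p] JetGmBar p n :=
  Algebra.TensorProduct.map (powJet p ν n) (AlgHom.id _ _)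

/-- The image in `𝒪^n(𝔾_m) ⊗_R k` of a polynomial in `R[x, x', …, x^(n)]`. -/
def toJetGmBar (n : ℕ) (f : jetPoly p n) : JetGmBar p n :=
  AdicCompletion.of _ (GmPoly p n) (algebraMap (jetPoly p n) (GmPoly p n) f) ⊗ₜ[ZpUr p] 1

/-- The ideal `(x', …, x^(ν))` of `𝒪^n(𝔾_m) ⊗_R k`. -/
def coordIdeal (ν n : ℕ) : Ideal (JetGmBar p n) :=
  Ideal.span {y | ∃ (i : ℕ) (h : i ≤ n), 1 ≤ i ∧ i ≤ ν ∧
    y = toJetGmBar p n ⟨MvPolynomial.X i, X_mem_jetPoly p h⟩}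

/-- The quotient of `𝒪^n(𝔾_m) ⊗_R k` by the ideal `(x', …, x^(ν))`. -/
abbrev JetGmBarQuot (ν n : ℕ) : Type := JetGmBar p n ⧸ coordIdeal p ν n

end Jets

end PJet
end

open scoped TensorProduct

noncomputable section

namespace PJet

/-! ### Congruences for the iterated `p`-derivatives of `x ^ p`. -/

section PolynomialCongruences

open MvPolynomial

variable (p : ℕ) [hp : Fact p.Prime]

/-! Modulo `p` the completion is invisible: `JetGmBar p n` is `k[x, x⁻¹, x', …, x^(n)]`, which is
used only through its universal property (`isUniversalCoords_coord`). Injectivity of the natural map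
follows at once, since forgetting the extra coordinates gives a retraction. The rest depends on the
shape of `δ^i (x ^ p ^ ν)` modulo `p`.

The case `ν = 1` is `iterate_delta_X_pow_p`. Modulo `p`, `δ^(j+1) (x ^ p)` has order at most `j`,
and `δ^(j+2) (x ^ p)` is `x^(pe) (x^(j+1))^p` plus terms of order at most `j`. An induction carries
the expansion modulo `p ^ 2`, because applying `δ` costs one power of `p`. It also records that the
part `h` not visibly divisible by `p` satisfies `DeltaSmall`: `δ h` involves the next variable only
with a factor `p`.

Since `[p^ν]^*` commutes with `δ`, the image of `x^(i)` under `[p^(ν+1)]^*` is the image of `δ^i (x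
^ p)` under `[p^ν]^*`. Induction on `ν` then gives `modP_powPoly_X`: modulo `p`, `[p^ν]^*` kills
`x', …, x^(ν)` and sends `x^(ν+l+1)` to a power of `x` times `(x^(l+1))^(p^ν)`, plus a polynomial in
`x, …, x^(l)`.

After dividing by `(x', …, x^(ν))` and renumbering, the map becomes a triangular endomorphism `x^(i)
↦ c_i (x^(i))^q + g_i` of `k[x, x⁻¹, x', …, x^(n-ν)]`, with `c_i` a unit. It is a composite of
elementary maps altering one coordinate each (`isFiniteFlatInjective_triangular`). Each of these
adjoins a root of a monic polynomial `T^q - a`, so it is finite, free and injective. -/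

theorem phi_C (a : ZpUr p) : phi p (C a) = C (WittVector.frobenius a) := by simp [phi]

theorem phi_X (i : ℕ) : phi p (X i) = X i ^ p + (p : DeltaPoly p) * X (i + 1) := by simp [phi]

theorem phi_eq (f : DeltaPoly p) : phi p f = f ^ p + p * delta p f := by
  rw [p_mul_delta]; ring

theorem delta_zero : delta p 0 = 0 := by
  apply mul_left_cancel₀ (p_ne_zero p)
  rw [p_mul_delta]
  simp [hp.out.ne_zero]

/-- As `p` is a nonzerodivisor in `R`, multiplication by `p` does not change the support of a
polynomial. This bounds the order of quotients by `p`. -/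
theorem mem_jetPoly_of_p_mul_mem {n : ℕ} {f : DeltaPoly p}
    (h1 : (p : DeltaPoly p) * f ∈ jetPoly p n) : f ∈ jetPoly p n := by
  have h0 : (p : ZpUr p) ≠ 0 := WittVector.p_nonzero p _
  rw [mem_supported] at h1 ⊢
  intro i hi
  apply h1
  rw [← map_natCast (C : ZpUr p →+* DeltaPoly p), ← smul_eq_C_mul]
  rw [Finset.mem_coe, mem_vars_iff_mem_support] at hi ⊢
  obtain ⟨d, hd, hid⟩ := hi
  refine ⟨d, ?_, hid⟩
  rw [mem_support_iff] at hd ⊢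
  rw [coeff_smul]
  exact mul_ne_zero h0 hd

theorem p_mem (n : ℕ) : (p : DeltaPoly p) ∈ jetPoly p n := natCast_mem _ _

theorem fermatC_mem {n : ℕ} {f g : DeltaPoly p} (hf : f ∈ jetPoly p n) (hg : g ∈ jetPoly p n) :
    fermatC p f g ∈ jetPoly p n :=
  neg_mem (sum_mem fun _ _ => mul_mem (mul_mem (natCast_mem _ _) (pow_mem hf _)) (pow_mem hg _))

/-- `(h + p t) ^ p ≡ h ^ p + p ^ 2 h ^ (p - 1) t` modulo `p ^ 3`, for odd `p`. -/
theorem add_p_mul_pow (hp2 : p ≠ 2) {n : ℕ} {h t : DeltaPoly p} (hh : h ∈ jetPoly p n)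
    (ht : t ∈ jetPoly p n) : ∃ r ∈ jetPoly p n,
      (h + p * t) ^ p = h ^ p + (p : DeltaPoly p) ^ 2 * (h ^ (p - 1) * t) +
        (p : DeltaPoly p) ^ 3 * r := by
  have hp3 : 3 ≤ p := by have := hp.out.two_le; omega
  obtain ⟨m, hm⟩ : ∃ m, p = m + 3 := ⟨p - 3, by omega⟩
  have key : (h + p * t) ^ p = ∑ i ∈ Finset.range (m + 2),
      ((p * t) ^ (i + 2) * h ^ (p - (i + 2)) * (p.choose (i + 2) : DeltaPoly p)) +
      (p * t) ^ 1 * h ^ (p - 1) * (p.choose 1 : DeltaPoly p) + h ^ p := by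
    rw [add_comm h, add_pow]
    have : p + 1 = m + 2 + 1 + 1 := by omega
    rw [this, Finset.sum_range_succ', Finset.sum_range_succ']
    simp
  have hterm : ∀ i ∈ Finset.range (m + 2), ∃ r ∈ jetPoly p n,
      (p * t) ^ (i + 2) * h ^ (p - (i + 2)) * (p.choose (i + 2) : DeltaPoly p) =
        (p : DeltaPoly p) ^ 3 * r := by
    intro i hi
    rw [Finset.mem_range] at hi
    rcases Nat.eq_zero_or_pos i with h0 | h0
    · subst h0
      -- Oddness of `p` enters here: for `2 < p` the binomial coefficient of the quadratic term
      -- supplies the third factor `p`.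
      obtain ⟨c, hc⟩ := hp.out.dvd_choose_self (k := 2) (by omega) (by omega)
      refine ⟨t ^ 2 * h ^ (p - 2) * c, mul_mem (mul_mem (pow_mem ht _) (pow_mem hh _))
        (natCast_mem _ _), ?_⟩
      rw [zero_add, hc]
      push_cast
      ring
    · obtain ⟨j, rfl⟩ : ∃ j, i = j + 1 := ⟨i - 1, by omega⟩
      refine ⟨p ^ j * t ^ (j + 3) * h ^ (p - (j + 3)) * p.choose (j + 3),
        mul_mem (mul_mem (mul_mem (pow_mem (p_mem p n) _) (pow_mem ht _)) (pow_mem hh _))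
          (natCast_mem _ _), ?_⟩
      ring
  choose! r hr1 hr2 using hterm
  refine ⟨∑ i ∈ Finset.range (m + 2), r i, sum_mem hr1, ?_⟩
  rw [key, Finset.sum_congr rfl hr2, ← Finset.mul_sum, Nat.choose_one_right]
  ring

/-- `f` has the property that `δ f` lies in `A^n + p A^(n+1)`. -/
def DeltaSmall (n : ℕ) (f : DeltaPoly p) : Prop :=
  ∃ a ∈ jetPoly p n, ∃ b ∈ jetPoly p (n + 1), delta p f = a + p * b

variable {p}

theorem DeltaSmall.add {n : ℕ} {f g : DeltaPoly p} (hf : f ∈ jetPoly p n) (hg : g ∈ jetPoly p n)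
    (h1 : DeltaSmall p n f) (h2 : DeltaSmall p n g) : DeltaSmall p n (f + g) := by
  obtain ⟨a, ha, b, hb, h⟩ := h1
  obtain ⟨a', ha', b', hb', h'⟩ := h2
  refine ⟨a + a' + fermatC p f g, add_mem (add_mem ha ha') (fermatC_mem p hf hg), b + b',
    add_mem hb hb', ?_⟩
  rw [(isPDerivation_delta p).map_add, h, h']
  ring

theorem DeltaSmall.of_mem {n : ℕ} {f : DeltaPoly p} (hf : f ∈ jetPoly p n) :
    DeltaSmall p (n + 1) f :=
  ⟨_, delta_mem p hf, 0, zero_mem _, by simp⟩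

/-- Dividing `φ (p f) - (p f) ^ p` by `p` gives `δ (p f) = f ^ p - p ^ (p - 1) f ^ p + p δ f`, whose
only term of order `n + 1` is `p δ f`. -/
theorem DeltaSmall.p_mul {n : ℕ} {f : DeltaPoly p} (hf : f ∈ jetPoly p n) :
    DeltaSmall p n (p * f) := by
  refine ⟨f ^ p - p ^ (p - 1) * f ^ p,
    sub_mem (pow_mem hf _) (mul_mem (pow_mem (p_mem p n) _) (pow_mem hf _)),
    delta p f, delta_mem p hf, ?_⟩
  apply mul_left_cancel₀ (p_ne_zero p)
  obtain ⟨m, hm⟩ : ∃ m, p = m + 1 := ⟨p - 1, by have := hp.out.two_le; omega⟩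
  have h2 : (p : DeltaPoly p) ^ p = p * p ^ (p - 1) := by
    rw [← pow_succ']; congr 1; omega
  rw [p_mul_delta, map_mul, map_natCast, phi_eq, mul_pow, h2]
  ring

/-- `φ (d ^ p) = (d ^ p + p δ d) ^ p` is congruent to `(d ^ p) ^ p` modulo `p ^ 2`, so `p` divides
`δ (d ^ p)`. In the product rule for `c * d ^ p`, only the term with `δ c` is then left without a
factor `p`. -/
theorem DeltaSmall.pow_mul {n : ℕ} {c d : DeltaPoly p} (hc : c ∈ jetPoly p n)
    (hd : d ∈ jetPoly p (n + 1)) : DeltaSmall p (n + 1) (c * d ^ p) := by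
  have hcd : ∃ r ∈ jetPoly p (n + 2), delta p (d ^ p) = p * r := by
    obtain ⟨r, hr⟩ : ∃ r, (d ^ p + p * delta p d) ^ p = (d ^ p) ^ p + p ^ 2 * r := by
      have h := Commute.add_pow (Commute.all (p * delta p d) (d ^ p)) p
      obtain ⟨m, hm⟩ : ∃ m, p = m + 2 := ⟨p - 2, by have := hp.out.two_le; omega⟩
      have e : p + 1 = m + 1 + 1 + 1 := by omega
      rw [e, Finset.sum_range_succ', Finset.sum_range_succ'] at h
      refine ⟨∑ k ∈ Finset.range (m + 1), p ^ k * delta p d ^ (k + 2) * (d ^ p) ^ (p - (k + 2)) *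
        p.choose (k + 2) + delta p d * (d ^ p) ^ (p - 1), ?_⟩
      rw [add_comm (d ^ p), h, mul_add, Finset.mul_sum]
      have : ∀ k, (p * delta p d) ^ (k + 1 + 1) * (d ^ p) ^ (p - (k + 1 + 1)) *
          ((p.choose (k + 1 + 1) : ℕ) : DeltaPoly p) = (p : DeltaPoly p) ^ 2 *
          (p ^ k * delta p d ^ (k + 2) * (d ^ p) ^ (p - (k + 2)) * p.choose (k + 2)) := by
        intro k; ring
      rw [Finset.sum_congr rfl fun k _ => this k]
      simp only [zero_add, Nat.choose_one_right, pow_one, pow_zero, Nat.choose_zero_right,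
        Nat.sub_zero]
      push_cast
      ring
    have h2 : delta p (d ^ p) = p * r := by
      apply mul_left_cancel₀ (p_ne_zero p)
      rw [p_mul_delta, map_pow, phi_eq, hr]
      ring
    exact ⟨r, mem_jetPoly_of_p_mul_mem p (h2 ▸ delta_mem p (pow_mem hd _)), h2⟩
  obtain ⟨r, hr, h⟩ := hcd
  have hle : n ≤ n + 2 := by omega
  refine ⟨(d ^ p) ^ p * delta p c, mul_mem (pow_mem (pow_mem hd _) _) (delta_mem p hc),
    c ^ p * r + p * (delta p c * r), add_mem (mul_mem (pow_mem (jetPoly_mono p hle hc) _) hr)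
      (mul_mem (p_mem p _) (mul_mem (jetPoly_mono p (by omega) (delta_mem p hc)) hr)), ?_⟩
  rw [(isPDerivation_delta p).map_mul, h]
  ring

variable (p) in
/-- The shape of `δ ^ (j + 1) (x ^ p)` modulo `p ^ 2`, together with that of
`δ ^ (j + 2) (x ^ p)` modulo `p`. -/
theorem iterate_delta_X_pow_p (hp2 : p ≠ 2) (j : ℕ) :
    ∃ (e : ℕ) (h r : DeltaPoly p), h ∈ jetPoly p j ∧ r ∈ jetPoly p (j + 1) ∧ DeltaSmall p j h ∧
      (delta p)^[j + 1] (X 0 ^ p) =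
        h + (p : DeltaPoly p) * (X 0 ^ e * X (j + 1)) + (p : DeltaPoly p) ^ 2 * r ∧
      ∃ a ∈ jetPoly p j, ∃ b, (delta p)^[j + 2] (X 0 ^ p) =
        X 0 ^ (p * e) * X (j + 1) ^ p + a + (p : DeltaPoly p) * b := by
  -- One application of `δ`. The bracket without the outer factor `p` will be the next `h`, and the
  -- exponent `e` becomes `p * e`.
  have step : ∀ (j e : ℕ) (h r : DeltaPoly p), h ∈ jetPoly p j → r ∈ jetPoly p (j + 1) →
      DeltaSmall p j h →
      (delta p)^[j + 1] (X 0 ^ p) =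
        h + (p : DeltaPoly p) * (X 0 ^ e * X (j + 1)) + (p : DeltaPoly p) ^ 2 * r →
      ∃ a ∈ jetPoly p j, ∃ b ∈ jetPoly p (j + 1), ∃ r' ∈ jetPoly p (j + 2),
        (delta p)^[j + 2] (X 0 ^ p) = (X 0 ^ (p * e) * X (j + 1) ^ p + a + (p : DeltaPoly p) * b) +
          (p : DeltaPoly p) * (X 0 ^ (p * e) * X (j + 2)) + (p : DeltaPoly p) ^ 2 * r' := by
    intro j e h r hh hr ⟨a, ha, b, hb, hab⟩ hy
    have hX : (X (j + 1) : DeltaPoly p) ∈ jetPoly p (j + 1) := X_mem_jetPoly p le_rfl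
    have hX0 : (X 0 : DeltaPoly p) ∈ jetPoly p (j + 1) := X_mem_jetPoly p (by omega)
    have hh' := jetPoly_mono p (Nat.le_succ j) hh
    have ht : X 0 ^ e * X (j + 1) + (p : DeltaPoly p) * r ∈ jetPoly p (j + 1) :=
      add_mem (mul_mem (pow_mem hX0 _) hX) (mul_mem (p_mem p _) hr)
    obtain ⟨w, hw, hpow⟩ := add_p_mul_pow p hp2 hh' ht
    obtain ⟨v, hv, hve⟩ : ∃ v ∈ jetPoly p (j + 1),
        (X 0 ^ p + (p : DeltaPoly p) * X 1) ^ e = X 0 ^ (p * e) + (p : DeltaPoly p) * v := by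
      have h1 : (p : DeltaPoly p) ∣ (X 0 ^ p + (p : DeltaPoly p) * X 1) ^ e - (X 0 ^ p) ^ e :=
        (Dvd.intro _ (by ring : (p : DeltaPoly p) * X 1 = _)).trans (sub_dvd_pow_sub_pow _ _ e)
      obtain ⟨v, hv⟩ := h1
      refine ⟨v, mem_jetPoly_of_p_mul_mem p ?_, ?_⟩
      · rw [← hv]
        exact sub_mem (pow_mem (add_mem (pow_mem hX0 _)
          (mul_mem (p_mem p _) (X_mem_jetPoly p (by omega)))) _) (pow_mem (pow_mem hX0 _) _)
      · rw [← hv]; ring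
    -- Write `y = h + p t` with `t = x^e x^(j+1) + p r`. The witnesses come from expanding `φ y - y
    -- ^ p`, dividing by `p`, and collecting separately the multiples of `p` of order at most `j +
    -- 1` and the multiples of `p ^ 2`.
    refine ⟨a, ha, b + v * X (j + 1) ^ p + r ^ p -
      h ^ (p - 1) * (X 0 ^ e * X (j + 1) + (p : DeltaPoly p) * r) -
        (p : DeltaPoly p) * w, ?_,
      v * X (j + 2) + delta p r, ?_, ?_⟩
    · exact sub_mem (sub_mem (add_mem (add_mem hb (mul_mem hv (pow_mem hX _))) (pow_mem hr _))
        (mul_mem (pow_mem hh' _) ht)) (mul_mem (p_mem p _) hw)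
    · exact add_mem (mul_mem (jetPoly_mono p (Nat.le_succ _) hv) (X_mem_jetPoly p le_rfl))
        (delta_mem p hr)
    · apply mul_left_cancel₀ (p_ne_zero p)
      have hy' : (delta p)^[j + 1] (X 0 ^ p) =
          h + (p : DeltaPoly p) * (X 0 ^ e * X (j + 1) + (p : DeltaPoly p) * r) := by
        rw [hy]; ring
      have hphi : phi p ((delta p)^[j + 1] (X 0 ^ p)) =
          h ^ p + (p : DeltaPoly p) * (a + (p : DeltaPoly p) * b) +
          (p : DeltaPoly p) * ((X 0 ^ (p * e) + (p : DeltaPoly p) * v) *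
            (X (j + 1) ^ p + (p : DeltaPoly p) * X (j + 2)) +
            (p : DeltaPoly p) * (r ^ p + (p : DeltaPoly p) * delta p r)) := by
        rw [hy', map_add, map_mul, map_natCast, map_add, map_mul, map_mul, map_natCast, map_pow,
          phi_X, phi_X, hve, phi_eq p h, phi_eq p r, hab]
      rw [Function.iterate_succ_apply', p_mul_delta, hphi, hy', hpow]
      ring
  have main : ∃ (e : ℕ) (h r : DeltaPoly p), h ∈ jetPoly p j ∧ r ∈ jetPoly p (j + 1) ∧
      DeltaSmall p j h ∧
      (delta p)^[j + 1] (X 0 ^ p) =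
        h + (p : DeltaPoly p) * (X 0 ^ e * X (j + 1)) + (p : DeltaPoly p) ^ 2 * r := by
    induction j with
    | zero =>
      have hX : (X 0 ^ p : DeltaPoly p) ∈ jetPoly p 1 := pow_mem (X_mem_jetPoly p (by omega)) _
      obtain ⟨r, hr, h⟩ := add_p_mul_pow p hp2 hX (X_mem_jetPoly p (le_refl 1))
      -- From `φ (x ^ p) = (x ^ p + p x') ^ p`: the linear term of the expansion gives `e = p (p -
      -- 1)`, and nothing is left for `h`.
      refine ⟨p * (p - 1), 0, r, zero_mem _, hr, ⟨0, zero_mem _, 0, zero_mem _, ?_⟩, ?_⟩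
      · rw [delta_zero]; ring
      · apply mul_left_cancel₀ (p_ne_zero p)
        rw [zero_add, Function.iterate_one, p_mul_delta, map_pow, phi_X, zero_add, h, pow_mul]
        ring
    | succ j ih =>
      obtain ⟨e, h, r, hh, hr, hs, hy⟩ := ih
      obtain ⟨a, ha, b, hb, r', hr', h'⟩ := step j e h r hh hr hs hy
      have hX0 : (X 0 ^ (p * e) : DeltaPoly p) ∈ jetPoly p j :=
        pow_mem (X_mem_jetPoly p (by omega)) _
      have hX : (X (j + 1) : DeltaPoly p) ∈ jetPoly p (j + 1) := X_mem_jetPoly p le_rfl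
      have m1 := mul_mem (jetPoly_mono p (Nat.le_succ j) hX0) (pow_mem hX p)
      have m2 := jetPoly_mono p (Nat.le_succ j) ha
      have m3 := mul_mem (p_mem p (j + 1)) hb
      -- The new `h` has three summands: a multiple of a `p`-th power, an element of lower order,
      -- and a multiple of `p`. There is one `DeltaSmall` criterion for each.
      exact ⟨p * e, _, r', add_mem (add_mem m1 m2) m3, hr',
        ((DeltaSmall.pow_mul hX0 hX).add m1 m2 (DeltaSmall.of_mem ha)).add (add_mem m1 m2) m3
          (DeltaSmall.p_mul hb), h'⟩
  obtain ⟨e, h, r, hh, hr, hs, hy⟩ := main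
  obtain ⟨a, ha, b, hb, r', hr', h'⟩ := step j e h r hh hr hs hy
  exact ⟨e, h, r, hh, hr, hs, hy, a, ha, b + X 0 ^ (p * e) * X (j + 2) + (p : DeltaPoly p) * r',
    by rw [h']; ring⟩

end PolynomialCongruences

/-! ### The shape of `[p^ν]^*` modulo `p`, by induction on `ν`. -/

section Powers

open MvPolynomial

variable (p : ℕ) [hp : Fact p.Prime]

theorem powPoly_X (ν i : ℕ) : powPoly p ν (X i) = (delta p)^[i] (X 0 ^ p ^ ν) := by
  rw [powPoly, aeval_X]

theorem powPoly_C (ν : ℕ) (a : ZpUr p) : powPoly p ν (C a) = C a := by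
  rw [powPoly, aeval_C, algebraMap_eq]

theorem powPoly_phi (ν : ℕ) (f : DeltaPoly p) :
    powPoly p ν (phi p f) = phi p (powPoly p ν f) := by
  have : (powPoly p ν : DeltaPoly p →+* DeltaPoly p).comp (phi p) =
      (phi p).comp (powPoly p ν : DeltaPoly p →+* DeltaPoly p) := by
    apply MvPolynomial.ringHom_ext
    · intro a
      simp only [RingHom.comp_apply, RingHom.coe_coe, phi_C, powPoly_C]
    · intro i
      simp only [RingHom.comp_apply, RingHom.coe_coe, phi_X, map_add, map_mul, map_pow,
        map_natCast, powPoly_X]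
      rw [phi_eq, Function.iterate_succ_apply']
  exact congrArg (fun g : DeltaPoly p →+* DeltaPoly p => g f) this

theorem powPoly_delta (ν : ℕ) (f : DeltaPoly p) :
    powPoly p ν (delta p f) = delta p (powPoly p ν f) := by
  apply mul_left_cancel₀ (p_ne_zero p)
  rw [p_mul_delta, ← powPoly_phi, ← map_natCast (powPoly p ν) p, ← map_mul, p_mul_delta, map_sub,
    map_pow]

/-- The recursion behind the induction on `ν`: `x ^ p ^ (ν + 1)` is the image of `x ^ p` under
`[p^ν]^*`, which commutes with `δ`. -/
theorem powPoly_succ_X (ν i : ℕ) :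
    powPoly p (ν + 1) (X i) = powPoly p ν ((delta p)^[i] (X 0 ^ p)) := by
  rw [powPoly_X, (Function.Commute.iterate_right (f := powPoly p ν) (g := delta p)
    (powPoly_delta p ν) i).eq, map_pow, powPoly_X, Function.iterate_zero, id, ← pow_mul, pow_succ]

/-- The endomorphism `x ↦ x`, `x^(i) ↦ 0` for `i ≥ 1`, of `R{x}`. -/
def killDerivatives : DeltaPoly p →ₐ[ZpUr p] DeltaPoly p :=
  aeval (fun i => if i = 0 then X 0 else 0)

theorem killDerivatives_X_zero : killDerivatives p (X 0) = X 0 := by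
  simp [killDerivatives]

theorem killDerivatives_X_succ (i : ℕ) : killDerivatives p (X (i + 1)) = 0 := by
  simp [killDerivatives]

/-- The ideal `(x', x'', …)` is stable under `φ`, because `φ (x^(i)) = (x^(i))^p + p x^(i+1)`. -/
theorem killDerivatives_phi (f : DeltaPoly p) :
    killDerivatives p (phi p (killDerivatives p f)) = killDerivatives p (phi p f) := by
  have : ((killDerivatives p : DeltaPoly p →+* DeltaPoly p).comp (phi p)).comp
      (killDerivatives p : DeltaPoly p →+* DeltaPoly p) =
      (killDerivatives p : DeltaPoly p →+* DeltaPoly p).comp (phi p) := by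
    apply MvPolynomial.ringHom_ext
    · intro a
      have hC : ∀ a, killDerivatives p (C a) = C a := fun a => by simp [killDerivatives]
      simp only [RingHom.comp_apply, RingHom.coe_coe, phi_C, hC]
    · rintro (_ | i)
      · simp only [RingHom.comp_apply, RingHom.coe_coe, killDerivatives_X_zero]
      · simp [phi_X, killDerivatives_X_succ, hp.out.ne_zero]
  exact congrArg (fun g : DeltaPoly p →+* DeltaPoly p => g f) this

/-- On setting all derivatives to zero, `φ (x ^ p)` becomes `(x ^ p) ^ p`, so `δ (x ^ p)` dies.
Stability of the kernel under `φ` passes this on to the higher derivatives. -/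
theorem killDerivatives_iterate_delta (i : ℕ) :
    killDerivatives p ((delta p)^[i + 1] (X 0 ^ p)) = 0 := by
  induction i with
  | zero =>
    apply mul_left_cancel₀ (p_ne_zero p)
    rw [zero_add, Function.iterate_one, ← map_natCast (killDerivatives p) p, ← map_mul,
      p_mul_delta]
    simp [phi_X, killDerivatives_X_zero, killDerivatives_X_succ]
  | succ i ih =>
    apply mul_left_cancel₀ (p_ne_zero p)
    rw [Function.iterate_succ_apply', ← map_natCast (killDerivatives p) p, ← map_mul,
      p_mul_delta, map_sub, map_pow, ← killDerivatives_phi, ih]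
    simp [hp.out.ne_zero]

theorem algHom_eqOn_jetPoly {S : Type*} [Semiring S] [Algebra (ZpUr p) S]
    {F G : DeltaPoly p →ₐ[ZpUr p] S} {n : ℕ} (h : ∀ i ≤ n, F (X i) = G (X i))
    {f : DeltaPoly p} (hf : f ∈ jetPoly p n) : F f = G f := by
  have hle : jetPoly p n ≤ AlgHom.equalizer F G := by
    refine Algebra.adjoin_le ?_
    rintro _ ⟨i, hi, rfl⟩
    exact h i hi
  exact hle hf

/-- Reduction of `R{x}` modulo `p`. -/
abbrev modP : DeltaPoly p →ₐ[ZpUr p] DeltaPoly p ⧸ Ideal.span {(p : DeltaPoly p)} :=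
  Ideal.Quotient.mkₐ _ _

theorem modP_eq_iff {f g : DeltaPoly p} : modP p f = modP p g ↔ ∃ b, f = g + p * b := by
  rw [modP, Ideal.Quotient.mkₐ_eq_mk, Ideal.Quotient.eq, Ideal.mem_span_singleton]
  exact exists_congr fun b => sub_eq_iff_eq_add'

/-- A check on generators that `[p^ν]^*` lowers the order by `ν` modulo `p`. The shape of `[p^ν]^*`
is taken as a hypothesis so that the lemma can serve inside the induction on `ν`. -/
theorem powPoly_of_mem_jetPoly {ν l : ℕ}
    (h0 : ∀ i, 1 ≤ i → i ≤ ν → modP p (powPoly p ν (X i)) = 0)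
    (h1 : ∀ l, ∃ e : ℕ, ∃ a ∈ jetPoly p l,
      modP p (powPoly p ν (X (ν + l + 1))) = modP p (X 0 ^ e * X (l + 1) ^ p ^ ν + a))
    {f : DeltaPoly p} (hf : f ∈ jetPoly p (ν + l)) :
    ∃ a ∈ jetPoly p l, modP p (powPoly p ν f) = modP p a := by
  have hle : jetPoly p (ν + l) ≤
      ((jetPoly p l).map (modP p)).comap ((modP p).comp (powPoly p ν)) := by
    refine Algebra.adjoin_le ?_
    rintro _ ⟨i, hi, rfl⟩
    change modP p (powPoly p ν (X i)) ∈ (jetPoly p l).map (modP p)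
    have hi' : i ≤ ν + l := hi
    rcases Nat.eq_zero_or_pos i with rfl | hi0
    · rw [powPoly_X]
      exact ⟨_, jetPoly_mono p (Nat.zero_le l) (iterate_delta_mem p ν 0), rfl⟩
    rcases Nat.lt_or_ge ν i with h | h
    · obtain ⟨j, rfl⟩ : ∃ j, i = ν + j + 1 := ⟨i - ν - 1, by omega⟩
      obtain ⟨e, a, ha, h'⟩ := h1 j
      rw [h']
      exact ⟨_, add_mem (mul_mem (pow_mem (X_mem_jetPoly p (Nat.zero_le _)) _)
        (pow_mem (X_mem_jetPoly p (by omega)) _)) (jetPoly_mono p (by omega) ha), rfl⟩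
    · rw [h0 i hi0 h]
      exact zero_mem _
  obtain ⟨a, ha, h⟩ := hle hf
  exact ⟨a, ha, h.symm⟩

/-- `δ ^ i (x ^ p ^ ν)` vanishes modulo `p` for `1 ≤ i ≤ ν`, and
`δ ^ (ν + l + 1) (x ^ p ^ ν) ≡ x ^ e (x ^ (l + 1)) ^ p ^ ν` modulo `p` and terms of lower order. -/
theorem modP_powPoly_X (hp2 : p ≠ 2) (ν : ℕ) :
    (∀ i, 1 ≤ i → i ≤ ν → modP p (powPoly p ν (X i)) = 0) ∧
    ∀ l, ∃ e : ℕ, ∃ a ∈ jetPoly p l,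
      modP p (powPoly p ν (X (ν + l + 1))) = modP p (X 0 ^ e * X (l + 1) ^ p ^ ν + a) := by
  induction ν with
  | zero =>
    refine ⟨fun i h1 h2 => by omega, fun l => ⟨0, 0, zero_mem _, ?_⟩⟩
    have : powPoly p 0 = AlgHom.id (ZpUr p) (DeltaPoly p) := by
      ext1 i
      rw [powPoly_X, AlgHom.id_apply, pow_zero, pow_one]
      induction i with
      | zero => rfl
      | succ i ih => rw [Function.iterate_succ_apply', ih, delta_X]
    rw [this]
    simp
  | succ ν ih =>
    obtain ⟨ih0, ih1⟩ := ih
    -- By induction `x', …, x^(ν)` go to zero, so on polynomials of order at most `ν` only the part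
    -- in `x` alone matters.
    have hkill : ∀ f ∈ jetPoly p ν,
        modP p (powPoly p ν f) = modP p (powPoly p ν (killDerivatives p f)) := by
      intro f hf
      refine algHom_eqOn_jetPoly p (F := (modP p).comp (powPoly p ν))
        (G := ((modP p).comp (powPoly p ν)).comp (killDerivatives p)) (n := ν) ?_ hf
      rintro (_ | i) hi
      · simp only [AlgHom.comp_apply, killDerivatives_X_zero]
      · simp only [AlgHom.comp_apply, killDerivatives_X_succ, map_zero]
        exact ih0 _ (by omega) hi
    have hp0 : modP p (p : DeltaPoly p) = 0 := by
      rw [modP, Ideal.Quotient.mkₐ_eq_mk, Ideal.Quotient.eq_zero_iff_mem]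
      exact Ideal.mem_span_singleton_self _
    have hmod : ∀ f g b : DeltaPoly p, f = g + p * b →
        modP p (powPoly p ν f) = modP p (powPoly p ν g) := by
      rintro f g b rfl
      simp only [map_add, map_mul, map_natCast]
      rw [← map_natCast (modP p), hp0, zero_mul, add_zero]
    refine ⟨fun i h1 h2 => ?_, fun l => ?_⟩
    · obtain ⟨j, rfl⟩ : ∃ j, i = j + 1 := ⟨i - 1, by omega⟩
      obtain ⟨e, h, r, hh, -, -, hy, -⟩ := iterate_delta_X_pow_p p hp2 j
      have hy' : (delta p)^[j + 1] (X 0 ^ p) =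
          h + (p : DeltaPoly p) * (X 0 ^ e * X (j + 1) + (p : DeltaPoly p) * r) := by rw [hy]; ring
      have hε := killDerivatives_iterate_delta p j
      -- `h` differs from `δ^(j+1) (x ^ p)` by a multiple of `p`, and the latter vanishes when the
      -- derivatives are killed. So the part of `h` in `x` alone is divisible by `p`.
      have h3 : killDerivatives p h =
          0 + p * -killDerivatives p (X 0 ^ e * X (j + 1) + (p : DeltaPoly p) * r) := by
        rw [hy', map_add, map_mul, map_natCast] at hε
        rw [eq_neg_of_add_eq_zero_left hε]
        ring
      rw [powPoly_succ_X, hmod _ _ _ hy', hkill h (jetPoly_mono p (by omega) hh), hmod _ _ _ h3,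
        map_zero, map_zero]
    · obtain ⟨e, h, r, -, -, -, -, a, ha, b, hy⟩ := iterate_delta_X_pow_p p hp2 (ν + l)
      obtain ⟨e', a', ha', h'⟩ := ih1 l
      obtain ⟨a₂, ha₂, h₂⟩ := powPoly_of_mem_jetPoly p ih0 ih1 ha
      have hchar : ∀ f g : DeltaPoly p, modP p ((f + g) ^ p) = modP p (f ^ p + g ^ p) := by
        intro f g
        rw [modP_eq_iff]
        exact ⟨-fermatC p f g, by rw [mul_neg, p_mul_fermatC]; ring⟩
      -- Substitute the inductive form of the image of `x^(ν+l+1)` into `x^(pe) (x^(ν+l+1))^p + a`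
      -- and distribute the `p`-th power over the sum modulo `p`.
      refine ⟨p ^ ν * (p * e) + e' * p, X 0 ^ (p ^ ν * (p * e)) * a' ^ p + a₂,
        add_mem (mul_mem (pow_mem (X_mem_jetPoly p (Nat.zero_le _)) _) (pow_mem ha' _)) ha₂, ?_⟩
      have hi : ν + 1 + l + 1 = ν + l + 2 := by ring
      have h₃ : modP p (powPoly p ν (X 0 ^ (p * e) * X (ν + l + 1) ^ p + a)) =
          modP p (powPoly p ν (X 0)) ^ (p * e) * modP p (powPoly p ν (X (ν + l + 1))) ^ p +
            modP p (powPoly p ν a) := by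
        simp only [map_add, map_mul, map_pow]
      have h₄ : modP p ((X 0 ^ e' * X (l + 1) ^ p ^ ν + a') ^ p) =
          modP p (X 0 ^ (e' * p) * X (l + 1) ^ p ^ (ν + 1) + a' ^ p) := by
        rw [hchar, mul_pow, ← pow_mul, ← pow_mul, ← pow_succ]
      rw [hi, powPoly_succ_X, hmod _ _ _ hy, h₃, h₂, h', ← map_pow (modP p) (_ + _) p, h₄,
        powPoly_X, Function.iterate_zero, id, ← map_pow, ← map_mul, ← map_add]
      refine congrArg (modP p) ?_
      rw [← pow_mul, pow_add]
      ring

end Powers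

/-! ### Finite, flat and injective homomorphisms from adjoining roots. -/

section FiniteFlatInjective

/-- A ring homomorphism that is finite, flat and injective. -/
def IsFiniteFlatInjective {A B : Type*} [CommRing A] [CommRing B] (f : A →+* B) : Prop :=
  f.Finite ∧ f.Flat ∧ Function.Injective f

theorem IsFiniteFlatInjective.comp {A B C : Type*} [CommRing A] [CommRing B] [CommRing C]
    {g : B →+* C} {f : A →+* B} (hg : IsFiniteFlatInjective g) (hf : IsFiniteFlatInjective f) :
    IsFiniteFlatInjective (g.comp f) :=
  ⟨hg.1.comp hf.1, hf.2.1.comp hg.2.1, hg.2.2.comp hf.2.2⟩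

theorem IsFiniteFlatInjective.of_bijective {A B : Type*} [CommRing A] [CommRing B] {f : A →+* B}
    (hf : Function.Bijective f) : IsFiniteFlatInjective f :=
  ⟨RingHom.Finite.of_surjective f hf.2, RingHom.Flat.of_bijective hf, hf.1⟩

open Polynomial in
-- The quotient by a monic polynomial is finite free. A monic polynomial of positive degree divides
-- no nonzero constant, whence injectivity.
theorem isFiniteFlatInjective_adjoinRoot_of {A : Type*} [CommRing A] {f : A[X]} (hf : f.Monic)
    (hd : 0 < f.natDegree) : IsFiniteFlatInjective (AdjoinRoot.of f) := by
  refine ⟨?_, ?_, ?_⟩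
  · have := hf.finite_adjoinRoot
    exact RingHom.finite_algebraMap.mpr this
  · have := hf.free_adjoinRoot
    exact RingHom.flat_algebraMap_iff.mpr (inferInstance : Module.Flat A (AdjoinRoot f))
  · rw [injective_iff_map_eq_zero]
    intro a ha
    by_contra h0
    have h1 : f ∣ C a := AdjoinRoot.mk_eq_zero.mp ha
    exact hf.not_dvd_of_natDegree_lt (C_ne_zero.mpr h0) (by rwa [natDegree_C]) h1

open Polynomial in
/-- A homomorphism `e : A → B` that identifies `B` with `A[b]`, where `b` is a universal `q`-th
root of `a`, is finite, flat and injective. -/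
theorem isFiniteFlatInjective_of_root {R A B : Type*} [CommRing R] [CommRing A] [CommRing B]
    [Algebra R A] [Algebra R B] (e : A →ₐ[R] B)
    {q : ℕ} (hq : 0 < q) {a : A} {b : B} (hb : b ^ q = e a)
    (s : B →ₐ[R] AdjoinRoot (X ^ q - C a : A[X])) (hsb : s b = AdjoinRoot.root _)
    (hse : s.comp e = AdjoinRoot.ofAlgHom R _)
    (hid : ∀ L : AdjoinRoot (X ^ q - C a : A[X]) →ₐ[R] B,
      (∀ x, L (AdjoinRoot.of _ x) = e x) → L (AdjoinRoot.root _) = b →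
        L.comp s = AlgHom.id R B) : IsFiniteFlatInjective (e : A →+* B) := by
  have hev : (X ^ q - C a : A[X]).eval₂ (e : A →+* B) b = 0 := by simp [hb]
  let L : AdjoinRoot (X ^ q - C a : A[X]) →ₐ[R] B := AdjoinRoot.liftAlgHom _ e b hev
  have hL : ∀ x, L (AdjoinRoot.of _ x) = e x := fun x => AdjoinRoot.lift_of hev
  have hLr : L (AdjoinRoot.root _) = b := AdjoinRoot.lift_root hev
  have h1 : L.comp s = AlgHom.id R B := hid L hL hLr
  have h2 : (s : B →+* AdjoinRoot (X ^ q - C a : A[X])).comp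
      (L : AdjoinRoot (X ^ q - C a : A[X]) →+* B) = RingHom.id _ := by
    apply AdjoinRoot.ringHom_ext
    · ext x
      change s (L (AdjoinRoot.of _ x)) = AdjoinRoot.of _ x
      rw [hL]
      exact DFunLike.congr_fun hse x
    · change s (L (AdjoinRoot.root _)) = AdjoinRoot.root _
      rw [hLr, hsb]
  have hbij : Function.Bijective (L : AdjoinRoot (X ^ q - C a : A[X]) →+* B) :=
    Function.bijective_iff_has_inverse.mpr
    ⟨s, fun x => DFunLike.congr_fun h2 x, fun x => DFunLike.congr_fun h1 x⟩
  have h3 : (e : A →+* B) = (L : AdjoinRoot (X ^ q - C a : A[X]) →+* B).comp (AdjoinRoot.of _) :=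
    RingHom.ext fun x => (hL x).symm
  -- Over the zero ring `X ^ q - C a` does not have degree `q`, so that case is separate.
  rcases subsingleton_or_nontrivial A with h | h
  · have : Subsingleton B := (e : A →+* B).codomain_trivial
    exact .of_bijective ⟨Function.injective_of_subsingleton _, fun y => ⟨0, Subsingleton.elim _ _⟩⟩
  · rw [h3]
    exact (IsFiniteFlatInjective.of_bijective hbij).comp (isFiniteFlatInjective_adjoinRoot_of
      (monic_X_pow_sub_C a hq.ne') (by rwa [natDegree_X_pow_sub_C]))

end FiniteFlatInjective

/-! ### Triangular endomorphisms of `(R / p)[x, x⁻¹, x', …, x^(m)]`. -/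

section UniversalCoordinates

variable {p m : ℕ} {R A : Type} [CommRing R] [CommRing A] [Algebra R A] {x : ℕ → A}

/-- The `R`-algebra `A` of characteristic `p` is `(R / p)[x, x⁻¹, x', …, x^(m)]`, expressed by
its universal property. -/
structure IsUniversalCoords (p m : ℕ) (R : Type) {A : Type} [CommRing R] [CommRing A]
    [Algebra R A] (x : ℕ → A) : Prop where
  natCast_eq_zero : (p : A) = 0
  isUnit : IsUnit (x 0)
  ext : ∀ {S : Type} [CommRing S] [Algebra R S] {F G : A →ₐ[R] S},
    (∀ i ≤ m, F (x i) = G (x i)) → F = G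
  exists_algHom : ∀ {S : Type} [CommRing S] [Algebra R S] (s : ℕ → S), (p : S) = 0 →
    IsUnit (s 0) → ∃ F : A →ₐ[R] S, ∀ i ≤ m, F (x i) = s i

variable (R) in
/-- `y` is a function of the coordinates `x^(j)`, `j < i`: algebra homomorphisms that agree
on these coordinates agree on `y`. -/
def DependsBelow (x : ℕ → A) (i : ℕ) (y : A) : Prop :=
  ∀ ⦃S : Type⦄ [CommRing S] [Algebra R S] (F G : A →ₐ[R] S),
    (∀ j < i, F (x j) = G (x j)) → F y = G y

namespace IsUniversalCoords

open Polynomial in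
/-- The endomorphism `x^(i) ↦ c (x^(i)) ^ q + g` that fixes the other coordinates. -/
theorem isFiniteFlatInjective_elementary (hx : IsUniversalCoords p m R x)
    {q : ℕ} (hq : 0 < q) {i : ℕ} (hi : i ≤ m)
    {c g : A} (hc : IsUnit c) (hc' : DependsBelow R x i c) (hg' : DependsBelow R x i g)
    (h0 : i = 0 → c = 1 ∧ g = 0) {E : A →ₐ[R] A}
    (hE : ∀ j ≤ m, j ≠ i → E (x j) = x j) (hEi : E (x i) = c * x i ^ q + g) :
    IsFiniteFlatInjective (E : A →+* A) := by
  obtain ⟨u, rfl⟩ := hc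
  have hEu : E u = u := hc' E (AlgHom.id _ _) fun j hj => hE j (by omega) (by omega)
  have hEu' : E (↑u⁻¹ : A) = (↑u⁻¹ : A) := by
    have h1 : u * E (↑u⁻¹ : A) = 1 := by
      rw [← congrArg (· * E (↑u⁻¹ : A)) hEu, ← map_mul, Units.mul_inv, map_one]
    exact Units.eq_inv_of_mul_eq_one_left h1
  have hEg : E g = g := hg' E (AlgHom.id _ _) fun j hj => hE j (by omega) (by omega)
  -- Solving `c T + g = x^(i)` for `T`: since `E` fixes `c` and `g`, it sends this `a` to
  -- `(x^(i))^q`, so `x^(i)` is a `q`-th root of `E a`.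
  let a : A := ↑u⁻¹ * (x i - g)
  have hb : x i ^ q = E a := by
    rw [map_mul, map_sub, hEi, hEu', hEg, add_sub_cancel_right, Units.inv_mul_cancel_left]
  let f : A[X] := X ^ q - C a
  let ofA : A →ₐ[R] AdjoinRoot f := AdjoinRoot.ofAlgHom R f
  have hroot : AdjoinRoot.root f ^ q = ofA a := by
    have h2 : AdjoinRoot.mk f (X ^ q - C a) = 0 := AdjoinRoot.mk_self
    rw [map_sub, map_pow, AdjoinRoot.mk_X, AdjoinRoot.mk_C] at h2
    exact sub_eq_zero.mp h2
  have hpS : (p : AdjoinRoot f) = 0 := by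
    rw [← map_natCast ofA, hx.natCast_eq_zero, map_zero]
  obtain ⟨s, hs⟩ := hx.exists_algHom
    (fun j => if j = i then AdjoinRoot.root f else ofA (x j)) hpS (by
      split_ifs with h
      -- For `i = 0` the root must be invertible. As `c = 1` and `g = 0`, its `q`-th power is the
      -- image of the unit `x`.
      · obtain ⟨h1, h2⟩ := h0 h.symm
        have h3 : IsUnit a := by
          refine (Units.isUnit _).mul ?_
          rw [h2, sub_zero, ← h]
          exact hx.isUnit
        have h4 := h3.map ofA
        rw [← hroot] at h4
        exact (isUnit_pow_iff hq.ne').mp h4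
      · exact hx.isUnit.map _)
  have hsi : s (x i) = AdjoinRoot.root f := by rw [hs i hi, if_pos rfl]
  have hsj : ∀ j ≤ m, j ≠ i → s (x j) = ofA (x j) := fun j hj hji => by
    rw [hs j hj, if_neg hji]
  have hsu : s u = ofA u := hc' s ofA fun j hj => hsj j (by omega) (by omega)
  have hsg : s g = ofA g := hg' s ofA fun j hj => hsj j (by omega) (by omega)
  have hsE : s.comp E = ofA := by
    apply hx.ext
    intro j hj
    by_cases hji : j = i
    · subst hji
      rw [AlgHom.comp_apply, hEi, map_add, map_mul, map_pow, hsi, hsu, hsg, hroot, ← map_mul,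
        ← map_add, Units.mul_inv_cancel_left, sub_add_cancel]
    · rw [AlgHom.comp_apply, hE j hj hji, hsj j hj hji]
  refine isFiniteFlatInjective_of_root E hq hb s hsi hsE fun L hL hLr => hx.ext fun j hj => ?_
  by_cases hji : j = i
  · subst hji
    rw [AlgHom.comp_apply, hsi]
    exact hLr
  · rw [AlgHom.comp_apply, hsj j hj hji, AlgHom.id_apply]
    exact (hL _).trans (hE j hj hji)

/-- A triangular endomorphism `x^(i) ↦ c_i (x^(i)) ^ q + g_i`, with `c_i` and `g_i` functions of
the lower coordinates and `c_i` a unit, is finite, flat and injective. -/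
theorem isFiniteFlatInjective_triangular (hx : IsUniversalCoords p m R x)
    {q : ℕ} (hq : 0 < q) {c g : ℕ → A}
    (hc : ∀ i, IsUnit (c i)) (hc' : ∀ i ≤ m, DependsBelow R x i (c i))
    (hg' : ∀ i ≤ m, DependsBelow R x i (g i)) (hc0 : c 0 = 1) (hg0 : g 0 = 0)
    {e : A →ₐ[R] A} (he : ∀ i ≤ m, e (x i) = c i * x i ^ q + g i) :
    IsFiniteFlatInjective (e : A →+* A) := by
  have key : ∀ t ≤ m + 1, ∀ T : A →ₐ[R] A,
      (∀ i ≤ m, T (x i) = if i < t then c i * x i ^ q + g i else x i) →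
      IsFiniteFlatInjective (T : A →+* A) := by
    intro t ht
    induction t with
    | zero =>
      intro T hT
      have h : T = AlgHom.id _ _ := hx.ext fun i hi => by
        rw [hT i hi, if_neg (Nat.not_lt_zero i), AlgHom.id_apply]
      rw [h]
      exact .of_bijective Function.bijective_id
    | succ t ih =>
      intro T hT
      have hx0 := hx.isUnit
      have hx0q : IsUnit (c 0 * x 0 ^ q + g 0) := by
        rw [hc0, hg0, one_mul, add_zero]
        exact hx0.pow q
      obtain ⟨T', hT'⟩ := hx.exists_algHom
        (fun i => if i < t then c i * x i ^ q + g i else x i) hx.natCast_eq_zero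
        (by split_ifs <;> assumption)
      obtain ⟨E, hE⟩ := hx.exists_algHom
        (fun i => if i = t then c i * x i ^ q + g i else x i) hx.natCast_eq_zero
        (by split_ifs <;> assumption)
      have hEne : ∀ j ≤ m, j ≠ t → E (x j) = x j := fun j hj hjt => by
        rw [hE j hj, if_neg hjt]
      -- `T'` alters the coordinates below `t`, and `E` only the one at `t`. The values of `T'`
      -- below `t` involve only coordinates that `E` fixes.
      have h1 : T = E.comp T' := by
        apply hx.ext
        intro i hi
        rw [AlgHom.comp_apply, hT i hi, hT' i hi]
        rcases lt_trichotomy i t with h | h | h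
        · have hE' : ∀ j < i, E (x j) = AlgHom.id R _ (x j) :=
            fun j hj => hEne j (by omega) (by omega)
          rw [if_pos (by omega), if_pos h, map_add, map_mul, map_pow, hEne i hi (by omega),
            hc' i hi E (AlgHom.id _ _) hE', hg' i hi E (AlgHom.id _ _) hE', AlgHom.id_apply,
            AlgHom.id_apply]
        · subst h
          rw [if_pos (by omega), if_neg (by omega), hE i hi, if_pos rfl]
        · rw [if_neg (by omega), if_neg (by omega), hEne i hi (by omega)]
      rw [h1]
      have h2 : IsFiniteFlatInjective (E : A →+* A) :=
        hx.isFiniteFlatInjective_elementary hq (show t ≤ m by omega) (hc t) (hc' t (by omega))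
          (hg' t (by omega)) (by rintro rfl; exact ⟨hc0, hg0⟩) hEne
          (by rw [hE t (by omega), if_pos rfl])
      exact h2.comp (ih (by omega) T' hT')
  exact key (m + 1) le_rfl e fun i hi => by rw [he i hi, if_pos (by omega)]

/-- An inclusion of coordinates induces an injective homomorphism. -/
theorem algHom_injective (hx : IsUniversalCoords p m R x) {B : Type} [CommRing B]
    [Algebra R B] {n : ℕ} (hmn : m ≤ n) {y : ℕ → B} (hy : IsUniversalCoords p n R y)
    {F : A →ₐ[R] B} (hF : ∀ i ≤ m, F (x i) = y i) : Function.Injective F := by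
  -- A retraction: coordinates up to `m` go back to themselves, and the values beyond `m` play no
  -- role.
  obtain ⟨r, hr⟩ := hy.exists_algHom x hx.natCast_eq_zero hx.isUnit
  have h1 : r.comp F = AlgHom.id R A := hx.ext fun i hi => by
    rw [AlgHom.comp_apply, hF i hi, hr i (hi.trans hmn), AlgHom.id_apply]
  exact Function.LeftInverse.injective (g := r) (DFunLike.congr_fun h1)

/-- Let `B` have coordinates `y`, `y', …, y^(n)` and `A` coordinates `x, x', …, x^(m)`, with
`n = ν + m`. A homomorphism `B → A` of the form `y ↦ x ^ q`, `y^(i) ↦ 0` for `1 ≤ i ≤ ν`,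
`y^(ν + i) ↦ c_i (x^(i)) ^ q + g_i` for `i ≥ 1` induces a finite, flat and injective homomorphism
`B / (y', …, y^(ν)) → A`. -/
theorem exists_quotient_algHom (hx : IsUniversalCoords p m R x) {B : Type} [CommRing B]
    [Algebra R B] {ν n : ℕ} (hn : n = ν + m) {y : ℕ → B} (hy : IsUniversalCoords p n R y)
    {q : ℕ} (hq : 0 < q) {c g : ℕ → A} (hc : ∀ i, IsUnit (c i))
    (hc' : ∀ i ≤ m, DependsBelow R x i (c i)) (hg' : ∀ i ≤ m, DependsBelow R x i (g i))
    (hc0 : c 0 = 1) (hg0 : g 0 = 0)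
    {I : Ideal B} (hI : I = Ideal.span {z | ∃ i, i ≤ n ∧ 1 ≤ i ∧ i ≤ ν ∧ z = y i})
    {F : B →ₐ[R] A} (hF0 : F (y 0) = x 0 ^ q) (hFν : ∀ i, 1 ≤ i → i ≤ ν → F (y i) = 0)
    (hF : ∀ i, 1 ≤ i → i ≤ m → F (y (ν + i)) = c i * x i ^ q + g i) :
    ∃ f : B ⧸ I →ₐ[R] A, (∀ b, f (Ideal.Quotient.mk I b) = F b) ∧
      IsFiniteFlatInjective (f : B ⧸ I →+* A) := by
  have hker : ∀ G : B →ₐ[R] A, (∀ i, 1 ≤ i → i ≤ ν → G (y i) = 0) → ∀ b ∈ I, G b = 0 := by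
    intro G hG b hb
    have hle : I ≤ RingHom.ker (G : B →+* A) := by
      rw [hI, Ideal.span_le]
      rintro _ ⟨i, -, h1, h2, rfl⟩
      exact hG i h1 h2
    exact hle hb
  let f : B ⧸ I →ₐ[R] A := Ideal.Quotient.liftₐ I F (hker F hFν)
  have hf : ∀ b, f (Ideal.Quotient.mk I b) = F b := fun b => rfl
  obtain ⟨e, he⟩ := hx.exists_algHom (fun i => c i * x i ^ q + g i) hx.natCast_eq_zero (by
    rw [hc0, hg0, one_mul, add_zero]
    exact hx.isUnit.pow q)
  -- `τ` kills `y', …, y^(ν)` and shifts the later indices down by `ν`. It induces an isomorphism `B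
  -- / I ≃ A` with inverse `σ`, and `F` is `τ` followed by the triangular map `e`.
  obtain ⟨τ, hτ⟩ := hy.exists_algHom
    (fun i => if i = 0 then x 0 else if i ≤ ν then 0 else x (i - ν)) hx.natCast_eq_zero
    (by rw [if_pos rfl]; exact hx.isUnit)
  have hτ0 : τ (y 0) = x 0 := by rw [hτ 0 (Nat.zero_le _), if_pos rfl]
  have hτν : ∀ i, 1 ≤ i → i ≤ ν → τ (y i) = 0 := fun i h1 h2 => by
    rw [hτ i (by omega), if_neg (by omega), if_pos h2]
  have hτx : ∀ i, 1 ≤ i → i ≤ m → τ (y (ν + i)) = x i := fun i h1 h2 => by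
    rw [hτ _ (by omega), if_neg (by omega), if_neg (by omega), Nat.add_sub_cancel_left]
  let τ' : B ⧸ I →ₐ[R] A := Ideal.Quotient.liftₐ I τ (hker τ hτν)
  let π : B →ₐ[R] B ⧸ I := Ideal.Quotient.mkₐ R I
  have hτ' : ∀ b, τ' (π b) = τ b := fun b => rfl
  have hπν : ∀ i, 1 ≤ i → i ≤ ν → π (y i) = 0 := fun i h1 h2 =>
    Ideal.Quotient.eq_zero_iff_mem.mpr (hI ▸ Ideal.subset_span ⟨i, by omega, h1, h2, rfl⟩)
  have hcases : ∀ i ≤ n, i = 0 ∨ (1 ≤ i ∧ i ≤ ν) ∨ ∃ j, 1 ≤ j ∧ j ≤ m ∧ i = ν + j := by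
    intro i hi
    rcases Nat.eq_zero_or_pos i with h | h
    · exact Or.inl h
    · rcases Nat.lt_or_ge ν i with h' | h'
      · exact Or.inr (Or.inr ⟨i - ν, by omega, by omega, by omega⟩)
      · exact Or.inr (Or.inl ⟨h, h'⟩)
  obtain ⟨σ, hσ⟩ := hx.exists_algHom (fun i => if i = 0 then π (y 0) else π (y (ν + i)))
    (by rw [← map_natCast π, hy.natCast_eq_zero, map_zero])
    (by rw [if_pos rfl]; exact hy.isUnit.map π)
  have hσ0 : σ (x 0) = π (y 0) := by rw [hσ 0 (Nat.zero_le _), if_pos rfl]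
  have hσx : ∀ i, 1 ≤ i → i ≤ m → σ (x i) = π (y (ν + i)) := fun i h1 h2 => by
    rw [hσ i h2, if_neg (by omega)]
  have h1 : τ'.comp σ = AlgHom.id R A := hx.ext fun i hi => by
    rcases Nat.eq_zero_or_pos i with rfl | h
    · rw [AlgHom.comp_apply, hσ0, hτ', hτ0, AlgHom.id_apply]
    · rw [AlgHom.comp_apply, hσx i h hi, hτ', hτx i h hi, AlgHom.id_apply]
  have h2 : σ.comp τ = π := hy.ext fun i hi => by
    rcases hcases i hi with rfl | ⟨h, h'⟩ | ⟨j, h, h', rfl⟩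
    · rw [AlgHom.comp_apply, hτ0, hσ0]
    · rw [AlgHom.comp_apply, hτν i h h', hπν i h h', map_zero]
    · rw [AlgHom.comp_apply, hτx j h h', hσx j h h']
  have h3 : e.comp τ = F := hy.ext fun i hi => by
    rcases hcases i hi with rfl | ⟨h, h'⟩ | ⟨j, h, h', rfl⟩
    · rw [AlgHom.comp_apply, hτ0, he 0 (Nat.zero_le _), hF0, hc0, hg0, one_mul, add_zero]
    · rw [AlgHom.comp_apply, hτν i h h', hFν i h h', map_zero]
    · rw [AlgHom.comp_apply, hτx j h h', he j h', hF j h h']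
  have hbij : Function.Bijective (τ' : B ⧸ I →+* A) := by
    refine Function.bijective_iff_has_inverse.mpr ⟨σ, fun z => ?_, DFunLike.congr_fun h1⟩
    obtain ⟨b, rfl⟩ := Ideal.Quotient.mk_surjective z
    exact DFunLike.congr_fun h2 b
  have h4 : (f : B ⧸ I →+* A) = (e : A →+* A).comp (τ' : B ⧸ I →+* A) := by
    apply Ideal.Quotient.ringHom_ext
    ext b
    exact (DFunLike.congr_fun h3 b).symm
  refine ⟨f, hf, ?_⟩
  rw [h4]
  exact (hx.isFiniteFlatInjective_triangular hq hc hc' hg' hc0 hg0 he).comp (.of_bijective hbij)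

/-- An endomorphism `P` of `B` of the form `y ↦ y ^ q`, `y^(i) ↦ 0` for `1 ≤ i ≤ ν`,
`y^(ν + i) ↦ y ^ e (y^(i)) ^ q + g`, with `g` a function of `y, …, y^(i-1)`, induces a finite, flat
and injective homomorphism `B / (y', …, y^(ν)) → A`, where `A ⊆ B` is the subring of functions
of `y, …, y^(m)`. -/
theorem exists_quotient_algHom_of_endomorphism (hx : IsUniversalCoords p m R x) {B : Type}
    [CommRing B] [Algebra R B] {ν n : ℕ} (hn : n = ν + m) {y : ℕ → B}
    (hy : IsUniversalCoords p n R y) {ι : A →ₐ[R] B} (hι : ∀ i ≤ m, ι (x i) = y i)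
    {q : ℕ} (hq : 0 < q) {I : Ideal B}
    (hI : I = Ideal.span {z | ∃ i, i ≤ n ∧ 1 ≤ i ∧ i ≤ ν ∧ z = y i})
    {P : B →ₐ[R] B} (hP0 : P (y 0) = y 0 ^ q) (hPν : ∀ i, 1 ≤ i → i ≤ ν → P (y i) = 0)
    (hP : ∀ l, l + 1 ≤ m → ∃ (e : ℕ) (g : A), DependsBelow R x (l + 1) g ∧
      P (y (ν + (l + 1))) = y 0 ^ e * y (l + 1) ^ q + ι g) :
    ∃ f : B ⧸ I →ₐ[R] A, (∀ b, ι (f (Ideal.Quotient.mk I b)) = P b) ∧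
      IsFiniteFlatInjective (f : B ⧸ I →+* A) := by
  choose! e g' hg₁ hg₂ using hP
  -- The values `1` and `0` at index `0` encode `x ↦ x ^ q`, so that `x` fits the triangular
  -- pattern.
  let c : ℕ → A := fun i => Nat.casesOn i 1 fun l => x 0 ^ e l
  let g : ℕ → A := fun i => Nat.casesOn i 0 g'
  have hcs : ∀ l, c (l + 1) = x 0 ^ e l := fun _ => rfl
  have hgs : ∀ l, g (l + 1) = g' l := fun _ => rfl
  have hc : ∀ i, IsUnit (c i) := by
    rintro (_ | l)
    · exact isUnit_one
    · exact hx.isUnit.pow _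
  have hc' : ∀ i ≤ m, DependsBelow R x i (c i) := by
    rintro (_ | l) - S _ _ F G h
    · exact (map_one F).trans (map_one G).symm
    · rw [hcs, map_pow, map_pow, h 0 (by omega)]
  have hg : ∀ i ≤ m, DependsBelow R x i (g i) := by
    rintro (_ | l) hl
    · intro S _ _ F G h
      exact (map_zero F).trans (map_zero G).symm
    · exact hg₁ l hl
  obtain ⟨F, hF⟩ := hy.exists_algHom
    (fun i => if i = 0 then x 0 ^ q else if i ≤ ν then 0 else c (i - ν) * x (i - ν) ^ q + g (i - ν))
    hx.natCast_eq_zero (by rw [if_pos rfl]; exact hx.isUnit.pow _)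
  have hF0 : F (y 0) = x 0 ^ q := by rw [hF 0 (Nat.zero_le _), if_pos rfl]
  have hFν : ∀ i, 1 ≤ i → i ≤ ν → F (y i) = 0 := fun i h2 h3 => by
    rw [hF i (by omega), if_neg (by omega), if_pos h3]
  have hFx : ∀ i, 1 ≤ i → i ≤ m → F (y (ν + i)) = c i * x i ^ q + g i := fun i h2 h3 => by
    rw [hF _ (by omega), if_neg (by omega), if_neg (by omega), Nat.add_sub_cancel_left]
  have hincl : ι.comp F = P := hy.ext fun i hi => by
    rw [AlgHom.comp_apply]
    rcases Nat.eq_zero_or_pos i with rfl | hi0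
    · rw [hF0, map_pow, hι 0 (Nat.zero_le _), hP0]
    rcases Nat.lt_or_ge ν i with h | h
    · obtain ⟨l, rfl⟩ : ∃ l, i = ν + (l + 1) := ⟨i - ν - 1, by omega⟩
      have hl : l + 1 ≤ m := by omega
      rw [hFx _ (by omega) hl, hcs, hgs, map_add, map_mul, map_pow, map_pow,
        hι 0 (Nat.zero_le _), hι _ hl, hg₂ l hl]
    · rw [hFν i hi0 h, map_zero, hPν i hi0 h]
  obtain ⟨f, hf, hfin⟩ := hx.exists_quotient_algHom hn hy hq hc hc' hg rfl rfl hI hF0 hFν hFx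
  exact ⟨f, fun z => by rw [hf]; exact DFunLike.congr_fun hincl z, hfin⟩

end IsUniversalCoords

end UniversalCoordinates

/-! ### The universal property of `𝒪^n(𝔾_m) ⊗_R k`. -/

section UniversalProperty

/-- Because `(p)` is finitely generated, the kernel of the projection from the completion to `A / p`
is generated by `p`. -/
theorem exists_eq_algebraMap_add_p_mul (p : ℕ) {A : Type*} [CommRing A] (y : PCompletion p A) :
    ∃ (a : A) (y' : PCompletion p A), y = algebraMap A _ a + p * y' := by
  obtain ⟨a, ha⟩ := Ideal.Quotient.mk_surjective
    (AdicCompletion.evalOneₐ (Ideal.span {(p : A)}) y)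
  have h : y - algebraMap _ _ a ∈
      RingHom.ker (AdicCompletion.evalOneₐ (Ideal.span {(p : A)})).toRingHom := by
    change AdicCompletion.evalOneₐ (Ideal.span {(p : A)}) _ = 0
    rw [map_sub, ← ha, AlgHom.commutes, sub_eq_zero]
    rfl
  rw [AdicCompletion.ker_evalOneₐ_eq_map _ (Submodule.fg_span_singleton _), Ideal.map_span,
    Set.image_singleton, map_natCast, Ideal.mem_span_singleton] at h
  obtain ⟨y', hy'⟩ := h
  exact ⟨a, y', by rw [← hy']; ring⟩

variable (p : ℕ) [hp : Fact p.Prime]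

/-- The natural map from `R[x, x⁻¹, x', …, x^(n)]` to `𝒪^n(𝔾_m) ⊗_R k`. -/
def gmPolyToBar (n : ℕ) : GmPoly p n →ₐ[ZpUr p] JetGmBar p n :=
  (Algebra.TensorProduct.includeLeft : JetGm p n →ₐ[ZpUr p] JetGmBar p n).comp
    (IsScalarTower.toAlgHom (ZpUr p) (GmPoly p n) (JetGm p n))

theorem p_eq_zero_jetGmBar (n : ℕ) : (p : JetGmBar p n) = 0 := by
  have h : (p : ResField p) = 0 := by
    have := Ideal.Quotient.eq_zero_iff_mem.mpr (Ideal.mem_span_singleton_self (p : ZpUr p))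
    rwa [map_natCast] at this
  have h2 := map_natCast (Algebra.TensorProduct.includeRight : ResField p →ₐ[ZpUr p] JetGmBar p n) p
  rw [← h2, h, map_zero]

/-- Passing to the completion adds only multiples of `p`, which vanish after tensoring with `k`. -/
theorem gmPolyToBar_surjective (n : ℕ) : Function.Surjective (gmPolyToBar p n) := by
  intro z
  induction z using TensorProduct.induction_on with
  | zero => exact ⟨0, map_zero _⟩
  | add a b ha hb =>
    obtain ⟨a', rfl⟩ := ha
    obtain ⟨b', rfl⟩ := hb
    exact ⟨a' + b', map_add _ _ _⟩
  | tmul y r =>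
    obtain ⟨r, rfl⟩ := Ideal.Quotient.mk_surjective r
    obtain ⟨a, y', rfl⟩ := exists_eq_algebraMap_add_p_mul p y
    refine ⟨r • a, ?_⟩
    have h3 : (Ideal.Quotient.mk (Ideal.span {(p : ZpUr p)}) r : ResField p) =
        r • (1 : ResField p) := by
      rw [Algebra.smul_def, mul_one]; rfl
    rw [h3, TensorProduct.tmul_smul, map_smul, TensorProduct.add_tmul]
    congr 1
    have h4 : ((p : JetGm p n) * y') ⊗ₜ[ZpUr p] (1 : ResField p) =
        (p : JetGmBar p n) * (y' ⊗ₜ[ZpUr p] 1) := by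
      rw [← map_natCast
        (Algebra.TensorProduct.includeLeft : JetGm p n →ₐ[ZpUr p] JetGmBar p n),
        Algebra.TensorProduct.includeLeft_apply, Algebra.TensorProduct.tmul_mul_tmul, mul_one]
    rw [h4, p_eq_zero_jetGmBar, zero_mul, add_zero]
    rfl

/-- The natural map from `R[x, x', …, x^(n)]` to `𝒪^n(𝔾_m) ⊗_R k`. -/
def jetPolyToBar (n : ℕ) : jetPoly p n →ₐ[ZpUr p] JetGmBar p n :=
  (gmPolyToBar p n).comp (IsScalarTower.toAlgHom (ZpUr p) (jetPoly p n) (GmPoly p n))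

theorem toJetGmBar_eq (n : ℕ) (f : jetPoly p n) : toJetGmBar p n f = jetPolyToBar p n f := rfl

/-- The class of `x^(i)` in `𝒪^n(𝔾_m) ⊗_R k` (zero if `i > n`). -/
def coord (n i : ℕ) : JetGmBar p n :=
  if h : i ≤ n then jetPolyToBar p n ⟨MvPolynomial.X i, X_mem_jetPoly p h⟩ else 0

variable {p}

theorem coord_of_le {n i : ℕ} (h : i ≤ n) :
    coord p n i = jetPolyToBar p n ⟨MvPolynomial.X i, X_mem_jetPoly p h⟩ := dif_pos h

theorem isUnit_coord_zero (n : ℕ) : IsUnit (coord p n 0) := by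
  rw [coord_of_le (Nat.zero_le n)]
  exact (IsLocalization.Away.algebraMap_isUnit (S := GmPoly p n) (xCoord p n)).map
    (gmPolyToBar p n)

/-- Algebra homomorphisms out of `R[x, x', …, x^(n)]` are determined on the generators; moreover
only the generators up to `m` matter on `R[x, x', …, x^(m)]`. -/
theorem jetPoly_eqOn {S : Type*} [Semiring S] [Algebra (ZpUr p) S] {m n : ℕ} (hmn : m ≤ n)
    {F G : jetPoly p n →ₐ[ZpUr p] S}
    (h : ∀ (i : ℕ) (hi : i ≤ m), F ⟨MvPolynomial.X i, X_mem_jetPoly p (hi.trans hmn)⟩ =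
      G ⟨MvPolynomial.X i, X_mem_jetPoly p (hi.trans hmn)⟩)
    {f : jetPoly p n} (hf : (f : DeltaPoly p) ∈ jetPoly p m) : F f = G f := by
  have hle : jetPoly p m ≤ (AlgHom.equalizer F G).map (jetPoly p n).val := by
    refine Algebra.adjoin_le ?_
    rintro _ ⟨i, hi, rfl⟩
    exact ⟨_, h i hi, rfl⟩
  obtain ⟨g, hg, hgf⟩ := hle hf
  obtain rfl : g = f := Subtype.ext hgf
  exact hg

theorem jetPolyToBar_eqOn {S : Type*} [Semiring S] [Algebra (ZpUr p) S] {m n : ℕ} (hmn : m ≤ n)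
    {F G : JetGmBar p n →ₐ[ZpUr p] S} (h : ∀ i ≤ m, F (coord p n i) = G (coord p n i))
    {f : jetPoly p n} (hf : (f : DeltaPoly p) ∈ jetPoly p m) :
    F (jetPolyToBar p n f) = G (jetPolyToBar p n f) := by
  refine jetPoly_eqOn hmn (F := F.comp (jetPolyToBar p n)) (G := G.comp (jetPolyToBar p n)) ?_ hf
  intro i hi
  have := h i hi
  rwa [coord_of_le (hi.trans hmn)] at this

theorem jetGmBar_algHom_ext {S : Type*} [CommSemiring S] [Algebra (ZpUr p) S] {n : ℕ}
    {F G : JetGmBar p n →ₐ[ZpUr p] S} (h : ∀ i ≤ n, F (coord p n i) = G (coord p n i)) :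
    F = G := by
  have h1 : F.comp (gmPolyToBar p n) = G.comp (gmPolyToBar p n) := by
    apply AlgHom.coe_ringHom_injective
    apply IsLocalization.ringHom_ext (Submonoid.powers (xCoord p n))
    ext f
    exact jetPolyToBar_eqOn le_rfl h f.2
  apply AlgHom.ext
  intro z
  obtain ⟨a, rfl⟩ := gmPolyToBar_surjective p n z
  exact DFunLike.congr_fun h1 a

/-- The universal property of `𝒪^n(𝔾_m) ⊗_R k`: the variable `x` can be sent to any unit and the
other variables to any elements of an `R`-algebra of characteristic `p`. -/
theorem exists_jetGmBar_algHom {S : Type*} [CommRing S] [Algebra (ZpUr p) S] (n : ℕ)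
    (hpS : (p : S) = 0) (s : ℕ → S) (hs : IsUnit (s 0)) :
    ∃ F : JetGmBar p n →ₐ[ZpUr p] S, ∀ i ≤ n, F (coord p n i) = s i := by
  let F₀ : jetPoly p n →ₐ[ZpUr p] S := (MvPolynomial.aeval s).comp (jetPoly p n).val
  have hF₀ : ∀ y : Submonoid.powers (xCoord p n), IsUnit (F₀ y) := by
    rintro ⟨_, r, rfl⟩
    have : F₀ (xCoord p n) = s 0 := by simp [F₀, xCoord]
    simp only [map_pow, this]
    exact hs.pow r
  let F₁ : GmPoly p n →ₐ[ZpUr p] S :=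
    IsLocalization.liftAlgHom (M := Submonoid.powers (xCoord p n)) (f := F₀) hF₀
  -- As `p = 0` in `S`, the map factors through `A / p`, the first layer of the completion, so no
  -- convergence question arises.
  have hF₁ : ∀ a ∈ Ideal.span {(p : GmPoly p n)}, F₁ a = 0 := by
    intro a ha
    obtain ⟨b, rfl⟩ := Ideal.mem_span_singleton.mp ha
    rw [map_mul, map_natCast, hpS, zero_mul]
  let F₂ : (GmPoly p n ⧸ Ideal.span {(p : GmPoly p n)}) →ₐ[ZpUr p] S :=
    Ideal.Quotient.liftₐ _ F₁ hF₁
  let F₃ : JetGm p n →ₐ[ZpUr p] S :=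
    F₂.comp ((AdicCompletion.evalOneₐ (Ideal.span {(p : GmPoly p n)})).restrictScalars (ZpUr p))
  have hk : ∀ a ∈ Ideal.span {(p : ZpUr p)}, Algebra.ofId (ZpUr p) S a = 0 := by
    intro a ha
    obtain ⟨b, rfl⟩ := Ideal.mem_span_singleton.mp ha
    rw [map_mul, map_natCast, hpS, zero_mul]
  let F : JetGmBar p n →ₐ[ZpUr p] S := Algebra.TensorProduct.lift F₃
    (Ideal.Quotient.liftₐ _ (Algebra.ofId (ZpUr p) S) hk : ResField p →ₐ[ZpUr p] S)
    (fun _ _ => Commute.all _ _)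
  refine ⟨F, fun i hi => ?_⟩
  have h1 : F (coord p n i) = F₁ (algebraMap (jetPoly p n) (GmPoly p n)
      ⟨MvPolynomial.X i, X_mem_jetPoly p hi⟩) := by
    rw [coord_of_le hi]
    change F (_ ⊗ₜ[ZpUr p] 1) = _
    rw [Algebra.TensorProduct.lift_tmul, map_one, mul_one]
    rfl
  rw [h1]
  have h2 : F₁ (algebraMap (jetPoly p n) (GmPoly p n) ⟨MvPolynomial.X i, X_mem_jetPoly p hi⟩) =
      F₀ ⟨MvPolynomial.X i, X_mem_jetPoly p hi⟩ := IsLocalization.lift_eq _ _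
  rw [h2]
  simp [F₀]

end UniversalProperty

/-! ### Transfer of the polynomial congruences to `𝒪^n(𝔾_m) ⊗_R k`. -/

section Reductions

theorem PCompletion.map_of (p : ℕ) {R A B : Type*} [CommRing R] [CommRing A] [CommRing B]
    [Algebra R A] [Algebra R B] (f : A →ₐ[R] B) (a : A) :
    PCompletion.map p f (AdicCompletion.of _ A a) = AdicCompletion.of _ B (f a) := by
  apply AdicCompletion.ext_evalₐ
  intro n
  rw [PCompletion.map, AdicCompletion.evalₐ_liftAlgHom, AdicCompletion.evalₐ_of]
  rw [AlgHom.comp_apply, AlgHom.restrictScalars_apply, AdicCompletion.evalₐ_of]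
  rfl

theorem map_pCompletionMap_of_tmul_one (p : ℕ) {R A B K : Type*} [CommRing R] [CommRing A]
    [CommRing B] [CommRing K] [Algebra R A] [Algebra R B] [Algebra R K] (f : A →ₐ[R] B) (a : A) :
    Algebra.TensorProduct.map (PCompletion.map p f) (AlgHom.id R K)
      (AdicCompletion.of _ A a ⊗ₜ[R] 1) = AdicCompletion.of _ B (f a) ⊗ₜ[R] 1 := by
  rw [Algebra.TensorProduct.map_tmul, map_one, PCompletion.map_of]

variable (p : ℕ) [hp : Fact p.Prime]

theorem isUniversalCoords_coord (n : ℕ) : IsUniversalCoords p n (ZpUr p) (coord p n) where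
  natCast_eq_zero := p_eq_zero_jetGmBar p n
  isUnit := isUnit_coord_zero n
  ext := jetGmBar_algHom_ext
  exists_algHom := fun s hpS hs => exists_jetGmBar_algHom n hpS s hs

theorem GmPoly.lift_algebraMap {m n : ℕ} (g : jetPoly p m →ₐ[ZpUr p] jetPoly p n)
    (hg : ∃ N, g (xCoord p m) = xCoord p n ^ N) (f : jetPoly p m) :
    GmPoly.lift p g hg (algebraMap _ _ f) = algebraMap _ _ (g f) :=
  IsLocalization.lift_eq _ _

theorem map_gmPolyToBar {m n : ℕ} (g : GmPoly p m →ₐ[ZpUr p] GmPoly p n) (f : GmPoly p m) :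
    Algebra.TensorProduct.map (PCompletion.map p g)
      (AlgHom.id (ZpUr p) (ResField p)) (gmPolyToBar p m f) = gmPolyToBar p n (g f) :=
  map_pCompletionMap_of_tmul_one p g f

theorem jetInclBar_jetPolyToBar {m n : ℕ} (h : m ≤ n) (f : jetPoly p m) :
    jetInclBar p h (jetPolyToBar p m f) =
      jetPolyToBar p n (Subalgebra.inclusion (jetPoly_mono p h) f) :=
  (map_gmPolyToBar p (inclGmPoly p h) _).trans
    (congrArg (gmPolyToBar p n) (GmPoly.lift_algebraMap p _ _ f))

theorem powJetBar_jetPolyToBar (ν n : ℕ) (f : jetPoly p n) :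
    powJetBar p ν n (jetPolyToBar p n f) = jetPolyToBar p n (powJetPoly p ν n f) :=
  (map_gmPolyToBar p (powGmPoly p ν n) _).trans
    (congrArg (gmPolyToBar p n) (GmPoly.lift_algebraMap p _ _ f))

theorem jetInclBar_coord {m n : ℕ} (h : m ≤ n) {i : ℕ} (hi : i ≤ m) :
    jetInclBar p h (coord p m i) = coord p n i := by
  rw [coord_of_le hi, coord_of_le (hi.trans h), jetInclBar_jetPolyToBar]
  rfl

/-- A congruence modulo `p` in `R{x}` between elements of `A^n` already holds in `A^n`, because the
quotient of their difference by `p` has order at most `n`. -/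
theorem jetPolyToBar_eq_of_modP {n : ℕ} {f g : jetPoly p n}
    (h : modP p (f : DeltaPoly p) = modP p (g : DeltaPoly p)) :
    jetPolyToBar p n f = jetPolyToBar p n g := by
  obtain ⟨b, hb⟩ := (modP_eq_iff p).mp h
  have hb' : b ∈ jetPoly p n := by
    apply mem_jetPoly_of_p_mul_mem p
    rw [← sub_eq_iff_eq_add'.mpr hb]
    exact sub_mem f.2 g.2
  have h1 : f = g + p * ⟨b, hb'⟩ := Subtype.ext (by rw [hb]; rfl)
  rw [h1, map_add, map_mul, map_natCast, p_eq_zero_jetGmBar, zero_mul, add_zero]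

theorem dependsBelow_jetPolyToBar {n l : ℕ} (hl : l ≤ n) {f : jetPoly p n}
    (hf : (f : DeltaPoly p) ∈ jetPoly p l) :
    DependsBelow (ZpUr p) (coord p n) (l + 1) (jetPolyToBar p n f) :=
  fun _ _ _ _ _ h => jetPolyToBar_eqOn hl (fun i hi => h i (by omega)) hf

theorem jetInclBar_injective {m n : ℕ} (h : m ≤ n) : Function.Injective (jetInclBar p h) :=
  (isUniversalCoords_coord p m).algHom_injective h (isUniversalCoords_coord p n)
    fun _ hi => jetInclBar_coord p h hi

theorem coordIdeal_eq (ν n : ℕ) : coordIdeal p ν n =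
    Ideal.span {z | ∃ i, i ≤ n ∧ 1 ≤ i ∧ i ≤ ν ∧ z = coord p n i} := by
  rw [coordIdeal]
  congr 1
  ext z
  refine exists_congr fun i => ⟨?_, ?_⟩
  · rintro ⟨h, h1, h2, h3⟩
    exact ⟨h, h1, h2, by rw [h3, coord_of_le h, toJetGmBar_eq]⟩
  · rintro ⟨h, h1, h2, h3⟩
    exact ⟨h, h1, h2, by rw [h3, coord_of_le h, toJetGmBar_eq]⟩

theorem powJetBar_coord (ν n : ℕ) {i : ℕ} (hi : i ≤ n) :
    powJetBar p ν n (coord p n i) = jetPolyToBar p n ⟨powPoly p ν (MvPolynomial.X i),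
      powPoly_mem p ν ⟨MvPolynomial.X i, X_mem_jetPoly p hi⟩⟩ := by
  rw [coord_of_le hi, powJetBar_jetPolyToBar]
  rfl

theorem powJetBar_coord_of_modP (ν : ℕ) {n i : ℕ} (hi : i ≤ n) (f : jetPoly p n)
    (h : modP p (powPoly p ν (MvPolynomial.X i)) = modP p (f : DeltaPoly p)) :
    powJetBar p ν n (coord p n i) = jetPolyToBar p n f := by
  rw [powJetBar_coord p ν n hi]
  exact jetPolyToBar_eq_of_modP p h

theorem powJetBar_coord_zero (ν n : ℕ) :
    powJetBar p ν n (coord p n 0) = coord p n 0 ^ p ^ ν := by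
  rw [powJetBar_coord_of_modP p ν (Nat.zero_le n) (xCoord p n ^ p ^ ν), map_pow,
    coord_of_le (Nat.zero_le n)]
  · rfl
  · rw [powPoly_X]
    rfl

theorem powJetBar_coord_of_le (hp2 : p ≠ 2) {ν n i : ℕ} (h1 : 1 ≤ i) (h2 : i ≤ ν) (hi : i ≤ n) :
    powJetBar p ν n (coord p n i) = 0 := by
  rw [powJetBar_coord_of_modP p ν hi 0, map_zero]
  rw [(modP_powPoly_X p hp2 ν).1 i h1 h2]
  exact (map_zero (modP p)).symm

theorem exists_powJetBar_coord (hp2 : p ≠ 2) {ν m n l : ℕ} (hn : n = ν + m) (hmn : m ≤ n)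
    (hl : l + 1 ≤ m) : ∃ (e : ℕ) (g : JetGmBar p m),
      DependsBelow (ZpUr p) (coord p m) (l + 1) g ∧
      powJetBar p ν n (coord p n (ν + (l + 1))) =
        coord p n 0 ^ e * coord p n (l + 1) ^ p ^ ν + jetInclBar p hmn g := by
  obtain ⟨e, a, ha, h⟩ := (modP_powPoly_X p hp2 ν).2 l
  have ha' : a ∈ jetPoly p m := jetPoly_mono p (by omega) ha
  refine ⟨e, jetPolyToBar p m ⟨a, ha'⟩, dependsBelow_jetPolyToBar p (by omega) ha, ?_⟩
  have h0 : coord p n 0 = jetPolyToBar p n (xCoord p n) := coord_of_le (Nat.zero_le n)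
  have hmap : ∀ u v w : jetPoly p n, jetPolyToBar p n (u ^ e * v ^ p ^ ν + w) =
      jetPolyToBar p n u ^ e * jetPolyToBar p n v ^ p ^ ν + jetPolyToBar p n w := fun u v w => by
    rw [map_add, map_mul, map_pow, map_pow]
  rw [h0, coord_of_le (hl.trans hmn), jetInclBar_jetPolyToBar, ← hmap]
  exact powJetBar_coord_of_modP p ν (by omega) _ h

theorem exists_algHom_jetGmBarQuot (hp2 : p ≠ 2) {ν m n : ℕ} (hn : n = ν + m) (hmn : m ≤ n) :
    ∃ f : JetGmBarQuot p ν n →ₐ[ZpUr p] JetGmBar p m,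
      (∀ z : JetGmBar p n, jetInclBar p hmn (f (Ideal.Quotient.mk _ z)) = powJetBar p ν n z) ∧
      IsFiniteFlatInjective (A := JetGmBarQuot p ν n) (B := JetGmBar p m)
        (f : JetGmBarQuot p ν n →+* JetGmBar p m) := by
  refine (isUniversalCoords_coord p m).exists_quotient_algHom_of_endomorphism hn
    (isUniversalCoords_coord p n) (fun i hi => jetInclBar_coord p hmn hi) (pow_pos hp.out.pos ν)
    (coordIdeal_eq p ν n) (powJetBar_coord_zero p ν n)
    (fun i h1 h2 => powJetBar_coord_of_le p hp2 h1 h2 (by omega))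
    (fun l hl => exists_powJetBar_coord p hp2 hn hmn hl)

end Reductions

end PJet

end

theorem corollary4p6 (p : ℕ) [Fact p.Prime] (hp : p ≠ 2) (ν n : ℕ) (hn : ν + 1 ≤ n) :
    Function.Injective (PJet.jetInclBar p (Nat.sub_le n ν)) ∧
    ∃ f : PJet.JetGmBarQuot p ν n →ₐ[PJet.ZpUr p] PJet.JetGmBar p (n - ν),
      (∀ a : PJet.JetGmBar p n,
        PJet.jetInclBar p (Nat.sub_le n ν) (f (Ideal.Quotient.mk _ a)) = PJet.powJetBar p ν n a) ∧
      Function.Injective f ∧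
      RingHom.Finite (A := PJet.JetGmBarQuot p ν n) (B := PJet.JetGmBar p (n - ν)) (f : PJet.JetGmBarQuot p ν n →+* PJet.JetGmBar p (n - ν)) ∧
      RingHom.Flat (R := PJet.JetGmBarQuot p ν n) (S := PJet.JetGmBar p (n - ν)) (f : PJet.JetGmBarQuot p ν n →+* PJet.JetGmBar p (n - ν)) := by
  refine ⟨PJet.jetInclBar_injective p _, ?_⟩
  obtain ⟨f, hf, hfin, hflat, hinj⟩ :=
    PJet.exists_algHom_jetGmBarQuot p hp (show n = ν + (n - ν) by omega) (Nat.sub_le n ν)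
  exact ⟨f, hf, hinj, hfin, hflat⟩
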